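/- Let $k$ be a field of characteristic zero. Let $T$ be the $k$-vector space spanned by the non-empty (non-planar) rooted trees, with the pre-Lie product $t\curvearrowright u$, the sum over the vertices $w$ of $u$ of the tree obtained by joining $w$ to the root of $t$ by a new edge. Let $(A,\rhd)$ be a left pre-Lie $k$-algebra. For $x\in A$ let $F_x:(T,\curvearrowright)\to(A,\rhd)$ be the unique morphism of pre-Lie algebras that maps the one-vertex tree $\bullet$ to $x$. For a linear form $\gamma$ on $T\oplus k\emptyset$ put $$B(\gamma;x)=\gamma(\emptyset)\mathbf 1+\sum_{t}h^{v(t)}\frac{\gamma(t)}{\sigma(t)}F_x(t)\in k\mathbf 1\oplus hA[[h]],$$ where $t$ runs over the non-empty rooted trees, $v(t)$ is the number of vertices and $\sigma(t)=|\mathrm{Aut}\,t|$. The same formula defines $B(\gamma;x)\in k\mathbf 1\oplus hA[[h]]$ for $x\in A[[h]]$, where $A[[h]]$ carries the $h$-linear extension of $\rhd$, $F_x(t)\in A[[h]]$, and the sum converges $h$-adically. Let $\mathcal S(T)$ be the symmetric algebra of $T$, with basis the rooted forests; it is the underlying algebra of both the bialgebra $\widetilde{\mathcal H}$ and the Connes–Kreimer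 Hopf algebra $\mathcal H_{CK}$. The coproduct of $\widetilde{\mathcal H}$ is the algebra morphism $\Delta:\mathcal S(T)\to\mathcal S(T)\otimes\mathcal S(T)$ given on trees by $\Delta(t)=\sum_s s\otimes t/s$. Here $s$ runs over the spanning subforests of $t$ (collections of disjoint subtrees such that each vertex of $t$ belongs to exactly one of them), and $t/s$ is obtained from $t$ by contracting each component of $s$ to a vertex. Let $\alpha,\beta$ be linear forms on $T$, extended to $T\oplus k\emptyset$ by $0$ on $\emptyset$. Then for every $a\in A$ $$B\bigl(\beta;\,h^{-1}B(\alpha;a)\bigr)=B(\alpha\star\beta;a).$$ Here $\alpha\star\beta=m_k\circ(\hat\alpha\otimes\hat\beta)\circ\Delta$, restricted to $T\oplus k\emptyset$ ($\emptyset$ being the empty forest, i.e. the unit of $\mathcal S(T)$), where $m_k$ is the product of $k$, $\hat\alpha$ is the multiplicative extension of $\alpha$ to forests, and $\hat\beta$ is the infinitesimal character of $\mathcal H_{CK}$ extending $\beta$ (it vanishes on the empty forest and on products of at least two trees). -/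

import Mathlib

/-- A rooted tree with a chosen ordering of the children of each vertex:
`node n c` is the tree whose root has the `n` branches `c 0, …, c (n - 1)`. -/
inductive PlaneTree : Type
  | node (n : ℕ) (c : Fin n → PlaneTree) : PlaneTree

namespace PlaneTree

/-- Isomorphisms of rooted trees, disregarding the order of the children: a bijection between
the branches at the roots, together with isomorphisms of the corresponding branches. -/
def Iso : PlaneTree → PlaneTree → Type
  | node n c, node m d => Σ e : Fin n ≃ Fin m, ∀ i, Iso (c i) (d (e i))

theorem Iso.refl : ∀ p : PlaneTree, Nonempty (Iso p p)
  | node _ c => ⟨⟨Equiv.refl _, fun i => (Iso.refl (c i)).some⟩⟩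

theorem Iso.symm : ∀ p q : PlaneTree, Nonempty (Iso p q) → Nonempty (Iso q p)
  | node n c, node m d, ⟨⟨e, f⟩⟩ =>
    ⟨⟨e.symm, fun i => by
      have h := Iso.symm (c (e.symm i)) (d (e (e.symm i))) ⟨f (e.symm i)⟩
      rw [e.apply_symm_apply] at h
      exact h.some⟩⟩

theorem Iso.trans : ∀ p q r : PlaneTree,
    Nonempty (Iso p q) → Nonempty (Iso q r) → Nonempty (Iso p r)
  | node _ c, node _ d, node _ b, ⟨⟨e, f⟩⟩, ⟨⟨e', f'⟩⟩ =>
    ⟨⟨e.trans e', fun i =>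
      (Iso.trans (c i) (d (e i)) (b (e' (e i))) ⟨f i⟩ ⟨f' (e i)⟩).some⟩⟩

instance finiteIso : ∀ p q : PlaneTree, Finite (Iso p q)
  | node n c, node m d => by
    have : ∀ e : Fin n ≃ Fin m, ∀ i, Finite (Iso (c i) (d (e i))) :=
      fun e i => finiteIso (c i) (d (e i))
    exact inferInstanceAs (Finite (Σ e : Fin n ≃ Fin m, ∀ i, Iso (c i) (d (e i))))

/-- Two plane trees are the same (non-planar) rooted tree when they are isomorphic. -/
instance setoid : Setoid PlaneTree where
  r p q := Nonempty (Iso p q)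
  iseqv := ⟨Iso.refl, fun {p q} => Iso.symm p q, fun {p q r} => Iso.trans p q r⟩

/-- The vertices of a tree: the root (`none`) and the vertices of the branches. -/
def Vertex : PlaneTree → Type
  | node n c => Option (Σ i : Fin n, Vertex (c i))

instance fintypeVertex : ∀ p : PlaneTree, Fintype (Vertex p)
  | node n c => by
    have : ∀ i, Fintype (Vertex (c i)) := fun i => fintypeVertex (c i)
    exact inferInstanceAs (Fintype (Option (Σ i : Fin n, Vertex (c i))))

/-- The number of vertices. -/
def order (p : PlaneTree) : ℕ := Fintype.card (Vertex p)

/-- `graftAt t u w` is the tree obtained from `u` by joining the root of `t` to the vertex `w` of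
`u` by a new edge. -/
def graftAt (t : PlaneTree) : (u : PlaneTree) → Vertex u → PlaneTree
  | node n c, none => node (n + 1) (Fin.cons t c)
  | node n c, some ⟨i, w⟩ => node n (Function.update c i (graftAt t (c i) w))

/-- The branches at the root. -/
def children : PlaneTree → List PlaneTree
  | node _ c => List.ofFn c

/-- The tree with a given list of branches at the root. -/
def ofList (l : List PlaneTree) : PlaneTree := node l.length l.get

/-- The sets of edges of a tree. An edge joins the root to the root of the `i`-th branch, or lies
in a branch; the Boolean says whether the edge from the root to the `i`-th branch is in the set.

Spanning subforests of a tree (collections of disjoint subtrees such that every vertex belongs to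
exactly one of them) are the same as sets of edges: the subtrees are the connected components of
the graph formed by all the vertices and the selected edges. -/
def SpanningSubforest : PlaneTree → Type
  | node n c => ∀ i : Fin n, Bool × SpanningSubforest (c i)

instance fintypeSpanningSubforest : ∀ p : PlaneTree, Fintype (SpanningSubforest p)
  | node n c => by
    have : ∀ i, Fintype (SpanningSubforest (c i)) := fun i => fintypeSpanningSubforest (c i)
    exact inferInstanceAs (Fintype (∀ i : Fin n, Bool × SpanningSubforest (c i)))

/-- The component of a spanning subforest that contains the root. -/
def rootComponent : (p : PlaneTree) → SpanningSubforest p → PlaneTree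
  | node n c, s =>
    ofList (((List.finRange n).filter fun i => (s i).1).map fun i => rootComponent (c i) (s i).2)

/-- The multiset of the components of a spanning subforest that do not contain the root. -/
def otherComponents : (p : PlaneTree) → SpanningSubforest p → Multiset PlaneTree
  | node n c, s =>
    ∑ i : Fin n, (otherComponents (c i) (s i).2 +
      if (s i).1 then 0 else {rootComponent (c i) (s i).2})

/-- The contracted tree `p / s`: every component of `s` is contracted to one vertex. -/
def contract : (p : PlaneTree) → SpanningSubforest p → PlaneTree
  | node n c, s =>
    ofList ((List.finRange n).flatMap fun i =>
      if (s i).1 then (contract (c i) (s i).2).children else [contract (c i) (s i).2])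

/-- The components of a spanning subforest. -/
def components (p : PlaneTree) (s : SpanningSubforest p) : Multiset PlaneTree :=
  rootComponent p s ::ₘ otherComponents p s

theorem order_node (n : ℕ) (c : Fin n → PlaneTree) :
    order (node n c) = (∑ i, order (c i)) + 1 := by
  change Fintype.card (Option (Σ i : Fin n, Vertex (c i))) = _
  rw [Fintype.card_option, Fintype.card_sigma]
  rfl

theorem order_graftAt (t : PlaneTree) : ∀ (p : PlaneTree) (w : Vertex p),
    order (graftAt t p w) = order t + order p
  | node n c, none => by
    rw [graftAt, order_node, order_node, Fin.sum_univ_succ]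
    simp only [Fin.cons_zero, Fin.cons_succ]
    omega
  | node n c, some ⟨i, w⟩ => by
    rw [graftAt, order_node, order_node]
    have h : ∀ j, order (Function.update c i (graftAt t (c i) w) j) =
        order (c j) + if j = i then order t else 0 := by
      intro j
      by_cases hj : j = i
      · subst hj
        simp [order_graftAt t (c j) w, add_comm]
      · simp [hj]
    simp only [h, Finset.sum_add_distrib, Finset.sum_ite_eq', Finset.mem_univ, if_true]
    omega

theorem finite_order_lt (m : ℕ) : {p : PlaneTree | p.order < m}.Finite := by
  induction m with
  | zero =>
    have : {p : PlaneTree | p.order < 0} = ∅ := by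
      ext p
      exact iff_of_false (Nat.not_lt_zero _) (Set.notMem_empty p)
    rw [this]; exact Set.finite_empty
  | succ m ih =>
    have : Finite {p : PlaneTree // p.order < m} := ih
    refine Set.Finite.subset (Set.finite_range
      (fun x : Σ n : Fin (m + 1), (Fin n → {p : PlaneTree // p.order < m}) =>
        node x.1 fun i => (x.2 i).1)) ?_
    rintro ⟨n, c⟩ h
    have h' : (∑ i, order (c i)) + 1 < m + 1 := by rw [← order_node]; exact h
    have hpos : ∀ i, 1 ≤ order (c i) := fun i => by
      rcases c i with ⟨l, d⟩
      rw [order_node]; omega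
    have hn : n ≤ ∑ i, order (c i) := by
      calc n = ∑ i : Fin n, 1 := by simp
        _ ≤ _ := Finset.sum_le_sum fun i _ => hpos i
    have hc : ∀ i, order (c i) < m := fun i => by
      have : order (c i) ≤ ∑ i, order (c i) := Finset.single_le_sum
        (f := fun i => order (c i)) (fun _ _ => Nat.zero_le _) (Finset.mem_univ i)
      omega
    exact ⟨⟨⟨n, by omega⟩, fun i => ⟨c i, hc i⟩⟩, rfl⟩

end PlaneTree

/-- Non-empty, non-planar rooted trees. -/
def RTree : Type := Quotient PlaneTree.setoid

namespace RTree

/-- The rooted tree underlying a plane tree. -/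
def mk (p : PlaneTree) : RTree := Quotient.mk _ p

/-- A plane representative of a rooted tree. -/
noncomputable def rep (t : RTree) : PlaneTree := Quotient.out t

theorem mk_rep (t : RTree) : mk t.rep = t := Quotient.out_eq t

theorem mk_eq_mk {p q : PlaneTree} : mk p = mk q ↔ Nonempty (PlaneTree.Iso p q) :=
  Quotient.eq

theorem mk_node {n m : ℕ} {c : Fin n → PlaneTree} {d : Fin m → PlaneTree} (e : Fin n ≃ Fin m)
    (h : ∀ i, mk (c i) = mk (d (e i))) : mk (.node n c) = mk (.node m d) :=
  mk_eq_mk.2 ⟨⟨e, fun i => (mk_eq_mk.1 (h i)).some⟩⟩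

/-- The tree with one vertex. -/
def leaf : RTree := mk (.node 0 Fin.elim0)

/-- The number `v(t)` of vertices of `t`. -/
noncomputable def order (t : RTree) : ℕ := t.rep.order

/-- The symmetry factor `σ(t)`: the number of automorphisms of the rooted tree `t`. -/
noncomputable def symmetryFactor (t : RTree) : ℕ := Nat.card (PlaneTree.Iso t.rep t.rep)

theorem finite_order_eq (n : ℕ) : {t : RTree | t.order = n}.Finite := by
  refine Set.Finite.of_finite_image (f := rep)
    ((PlaneTree.finite_order_lt (n + 1)).subset ?_) ?_
  · rintro _ ⟨t, ht, rfl⟩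
    have : t.order = n := ht
    change t.order < n + 1
    omega
  · intro t _ u _ h
    rw [← mk_rep t, ← mk_rep u, h]

/-- The finite set of rooted trees with `n` vertices. -/
noncomputable def ofOrder (n : ℕ) : Finset RTree := (finite_order_eq n).toFinset

theorem mem_ofOrder {n : ℕ} {t : RTree} : t ∈ ofOrder n ↔ t.order = n := by
  simp [ofOrder]

end RTree

/-- The vector space `T` spanned by the non-empty rooted trees. -/
abbrev TreeSpace (k : Type*) [Semiring k] : Type _ := RTree →₀ k

namespace TreeSpace

variable (k : Type*) [Field k]

/-- A rooted tree as a basis vector of `T`. -/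
noncomputable def tree (t : RTree) : TreeSpace k := Finsupp.single t 1

/-- The sum of all the ways of grafting the tree `t` on a vertex of the tree `u`. -/
noncomputable def graftTree (t u : RTree) : TreeSpace k :=
  ∑ w : PlaneTree.Vertex u.rep, tree k (RTree.mk (PlaneTree.graftAt t.rep u.rep w))

/-- The grafting product `t ↷ u` of `T`, extended bilinearly from trees. -/
noncomputable def graft : TreeSpace k →ₗ[k] TreeSpace k →ₗ[k] TreeSpace k :=
  Finsupp.linearCombination k fun t => Finsupp.linearCombination k fun u => graftTree k t u

variable {k}

theorem graft_tree (t u : RTree) : graft k (tree k t) (tree k u) = graftTree k t u := by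
  simp [graft, tree]

/-- Grafting on vertices does not depend on the chosen plane representatives. -/
theorem exists_vertex_equiv {t t' : PlaneTree} (ht : RTree.mk t = RTree.mk t') :
    ∀ p q : PlaneTree, RTree.mk p = RTree.mk q →
      ∃ e : p.Vertex ≃ q.Vertex, ∀ w,
        RTree.mk (PlaneTree.graftAt t p w) = RTree.mk (PlaneTree.graftAt t' q (e w))
  | .node n c, .node m d, h => by
    obtain ⟨⟨e, f⟩⟩ := RTree.mk_eq_mk.1 h
    have hcd : ∀ i, RTree.mk (c i) = RTree.mk (d (e i)) := fun i => RTree.mk_eq_mk.2 ⟨f i⟩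
    choose E hE using fun i => exists_vertex_equiv ht (c i) (d (e i)) (hcd i)
    refine ⟨(Equiv.sigmaCongr e E).optionCongr, ?_⟩
    rintro (_ | ⟨i, w⟩)
    · refine RTree.mk_node ((finSuccEquiv n).trans
        (e.optionCongr.trans (finSuccEquiv m).symm)) fun i => ?_
      refine Fin.cases ?_ (fun i => ?_) i
      · simpa using ht
      · simpa using hcd i
    · refine RTree.mk_node e fun j => ?_
      change RTree.mk (Function.update c i (PlaneTree.graftAt t (c i) w) j) =
        RTree.mk (Function.update d (e i) (PlaneTree.graftAt t' (d (e i)) (E i w)) (e j))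
      by_cases h : j = i
      · subst h
        simpa using hE j w
      · have h' : e j ≠ e i := fun h' => h (e.injective h')
        rw [Function.update_of_ne h, Function.update_of_ne h', hcd]

theorem graft_mk (t u : PlaneTree) :
    graft k (tree k (RTree.mk t)) (tree k (RTree.mk u)) =
      ∑ w : u.Vertex, tree k (RTree.mk (PlaneTree.graftAt t u w)) := by
  rw [graft_tree, graftTree]
  obtain ⟨e, he⟩ := exists_vertex_equiv (RTree.mk_rep (RTree.mk t)) _ _ (RTree.mk_rep (RTree.mk u))
  exact Fintype.sum_equiv e _ _ fun w => by rw [he]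

end TreeSpace

section PreLie

variable {A : Type*} [LeftPreLieRing A]

/-- The symmetric brace `a{v 0, …, v (n - 1)}` of a left pre-Lie algebra. -/
def brace (a : A) : (n : ℕ) → (Fin n → A) → A
  | 0, _ => a
  | n + 1, v => v 0 * brace a n (Fin.tail v) -
      ∑ i, brace a n (Function.update (Fin.tail v) i (v 0 * Fin.tail v i))

theorem brace_cons (a : A) (n : ℕ) (x : A) (v : Fin n → A) :
    brace a (n + 1) (Fin.cons x v) =
      x * brace a n v - ∑ i, brace a n (Function.update v i (x * v i)) := by
  simp [brace]

theorem brace_update_add (a : A) : ∀ (n : ℕ) (v : Fin n → A) (j : Fin n) (x y : A),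
    brace a n (Function.update v j (x + y)) =
      brace a n (Function.update v j x) + brace a n (Function.update v j y) := by
  intro n
  induction n with
  | zero => intro v j; exact j.elim0
  | succ n ih =>
    intro v j x y
    rw [← Fin.cons_self_tail v]
    generalize v 0 = z
    generalize Fin.tail v = u
    refine Fin.cases ?_ (fun j => ?_) j
    · simp only [Fin.update_cons_zero, brace_cons, add_mul, ih, Finset.sum_add_distrib]
      abel
    · simp only [← Fin.cons_update, brace_cons, ih, mul_add]
      have : ∀ i, brace a n (Function.update (Function.update u j (x + y)) i
            (z * Function.update u j (x + y) i)) =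
          brace a n (Function.update (Function.update u j x) i (z * Function.update u j x i)) +
          brace a n (Function.update (Function.update u j y) i
            (z * Function.update u j y i)) := by
        intro i
        by_cases h : i = j
        · subst h; simp [mul_add, ih]
        · simp only [Function.update_of_ne h, Function.update_comm (Ne.symm h), ih]
      simp only [this, Finset.sum_add_distrib]
      abel

theorem brace_update_sum (a : A) {n : ℕ} (v : Fin n → A) (j : Fin n) {ι : Type*}
    (s : Finset ι) (f : ι → A) :
    brace a n (Function.update v j (∑ i ∈ s, f i)) =
      ∑ i ∈ s, brace a n (Function.update v j (f i)) :=
  map_sum (AddMonoidHom.mk' (fun x => brace a n (Function.update v j x))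
    (brace_update_add a n v j)) f s

theorem brace_swap_zero (a x y : A) (n : ℕ) (w : Fin n → A) :
    brace a (n + 2) (Fin.cons x (Fin.cons y w)) = brace a (n + 2) (Fin.cons y (Fin.cons x w)) := by
  have expand : ∀ x y : A, brace a (n + 2) (Fin.cons x (Fin.cons y w)) =
      (x * (y * brace a n w) - x * y * brace a n w)
      - (∑ i, x * brace a n (Function.update w i (y * w i)) +
         ∑ i, y * brace a n (Function.update w i (x * w i)))
      + ∑ j, (brace a n (Function.update w j (x * y * w j)) +
          ∑ i, brace a n (Function.update (Function.update w j (x * w j)) i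
            (y * Function.update w j (x * w j) i))) := by
    intro x y
    rw [brace_cons, brace_cons, Fin.sum_univ_succ]
    simp only [Fin.cons_zero, Fin.cons_succ, Fin.update_cons_zero, ← Fin.cons_update, brace_cons,
      Finset.sum_sub_distrib, mul_sub, Finset.mul_sum, Finset.sum_add_distrib]
    abel
  have split : ∀ x y : A, ∀ j, ∑ i, brace a n (Function.update (Function.update w j (x * w j)) i
            (y * Function.update w j (x * w j) i)) =
      brace a n (Function.update w j (y * (x * w j))) +
        ∑ i ∈ Finset.univ.erase j, brace a n (Function.update (Function.update w j (x * w j)) i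
          (y * w i)) := by
    intro x y j
    rw [← Finset.add_sum_erase _ _ (Finset.mem_univ j)]
    congr 1
    · simp
    · refine Finset.sum_congr rfl fun i hi => ?_
      rw [Function.update_of_ne (Finset.ne_of_mem_erase hi)]
  have hsym : ∑ j, ∑ i ∈ Finset.univ.erase j,
        brace a n (Function.update (Function.update w j (x * w j)) i (y * w i)) =
      ∑ j, ∑ i ∈ Finset.univ.erase j,
        brace a n (Function.update (Function.update w j (y * w j)) i (x * w i)) := by
    rw [Finset.sum_comm' (t' := Finset.univ) (s' := fun i => Finset.univ.erase i)]
    · refine Finset.sum_congr rfl fun i _ => Finset.sum_congr rfl fun j hj => ?_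
      rw [Function.update_comm (Finset.ne_of_mem_erase hj)]
    · intro i j; simp [ne_comm]
  have hass : ∀ z : A, x * y * z - x * (y * z) = y * x * z - y * (x * z) :=
    fun z => LeftPreLieRing.assoc_symm x y z
  have hdiag : ∀ j, brace a n (Function.update w j (x * y * w j)) +
        brace a n (Function.update w j (y * (x * w j))) =
      brace a n (Function.update w j (y * x * w j)) +
        brace a n (Function.update w j (x * (y * w j))) := by
    intro j
    rw [← brace_update_add, ← brace_update_add]
    congr 2
    have := hass (w j)
    rw [sub_eq_sub_iff_add_eq_add] at this
    exact this
  rw [expand x y, expand y x]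
  simp only [split, ← add_assoc, hdiag]
  rw [Finset.sum_add_distrib (f := fun j => brace a n (Function.update w j (y * x * w j)) +
    brace a n (Function.update w j (x * (y * w j)))), hsym, ← Finset.sum_add_distrib]
  have h1 := hass (brace a n w)
  have h2 : x * (y * brace a n w) - x * y * brace a n w =
      y * (x * brace a n w) - y * x * brace a n w := by
    rw [← neg_sub, h1, neg_sub]
  rw [h2]
  simp only [Finset.sum_add_distrib]
  abel

theorem brace_perm (a : A) : ∀ (n : ℕ) (v : Fin n → A) (e : Equiv.Perm (Fin n)),
    brace a n (v ∘ e) = brace a n v := by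
  intro n
  induction n with
  | zero => intro v e; rfl
  | succ n ih =>
    intro v e
    have key : ∀ (v : Fin (n + 1) → A) (i : Fin n),
        brace a (n + 1) (v ∘ Equiv.swap i.castSucc i.succ) = brace a (n + 1) v := by
      intro v i
      rw [← Fin.cons_self_tail v]
      generalize v 0 = x
      generalize Fin.tail v = u
      rcases n with _ | n
      · exact i.elim0
      refine Fin.cases ?_ (fun j => ?_) i
      · have : (Fin.cons x u : Fin (n + 2) → A) ∘ Equiv.swap (Fin.castSucc 0) (Fin.succ 0) =
            Fin.cons (u 0) (Fin.cons x (Fin.tail u)) := by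
          funext l
          refine Fin.cases ?_ (fun l => ?_) l
          · simp
          · refine Fin.cases ?_ (fun l => ?_) l
            · simp
            · rw [Function.comp_apply, Equiv.swap_apply_of_ne_of_ne]
              · simp [Fin.tail]
              · simp [Fin.ext_iff]
              · simp [Fin.ext_iff]
        rw [this, brace_swap_zero, Fin.cons_self_tail]
      · have : (Fin.cons x u : Fin (n + 2) → A) ∘ Equiv.swap j.succ.castSucc j.succ.succ =
            Fin.cons x (u ∘ Equiv.swap j.castSucc j.succ) := by
          funext l
          refine Fin.cases ?_ (fun l => ?_) l
          · rw [Function.comp_apply, Equiv.swap_apply_of_ne_of_ne] <;> simp [Fin.ext_iff]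
          · rw [Function.comp_apply, Fin.cons_succ, Function.comp_apply, ← Fin.succ_castSucc,
              ← (Fin.succ_injective _).map_swap, Fin.cons_succ]
        rw [this, brace_cons, brace_cons, ih]
        congr 1
        refine Fintype.sum_equiv (Equiv.swap j.castSucc j.succ) _ _ fun l => ?_
        rw [← ih (Function.update u _ _) (Equiv.swap j.castSucc j.succ)]
        congr 1
        rw [Function.update_comp_equiv]
        simp
    have he : e ∈ Submonoid.closure
        (Set.range fun i : Fin n => Equiv.swap i.castSucc i.succ) := by
      rw [Equiv.Perm.mclosure_swap_castSucc_succ]; trivial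
    induction he using Submonoid.closure_induction generalizing v with
    | mem x hx => obtain ⟨i, rfl⟩ := hx; exact key v i
    | one => rfl
    | mul x y _ _ hx hy =>
      rw [show v ∘ ⇑(x * y) = (v ∘ x) ∘ y from rfl, hy, hx]

/-- The elementary differential of a plane tree: `a` for the one-vertex tree, and the brace
`a{F (c 0), …, F (c (n - 1))}` for the tree with branches `c 0, …, c (n - 1)`. -/
def planeDiff (a : A) : PlaneTree → A
  | .node n c => brace a n fun i => planeDiff a (c i)

theorem planeDiff_iso (a : A) : ∀ p q : PlaneTree, Nonempty (PlaneTree.Iso p q) →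
    planeDiff a p = planeDiff a q
  | .node n c, .node m d, ⟨⟨e, f⟩⟩ => by
    obtain rfl : n = m := by simpa using Fintype.card_congr e
    have : (fun i => planeDiff a (c i)) = (fun i => planeDiff a (d i)) ∘ e := by
      funext i
      exact planeDiff_iso a (c i) (d (e i)) ⟨f i⟩
    rw [planeDiff, planeDiff, this, brace_perm]

theorem sum_planeDiff_graftAt (a : A) (t : PlaneTree) : ∀ p : PlaneTree,
    ∑ w : p.Vertex, planeDiff a (PlaneTree.graftAt t p w) = planeDiff a t * planeDiff a p
  | .node n c => by
    have h1 : ∑ w : PlaneTree.Vertex (.node n c), planeDiff a (PlaneTree.graftAt t (.node n c) w) =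
        planeDiff a (.node (n + 1) (Fin.cons t c)) +
          ∑ i, ∑ w : (c i).Vertex,
            planeDiff a (.node n (Function.update c i (PlaneTree.graftAt t (c i) w))) := by
      rw [← Fintype.sum_sigma']
      exact Fintype.sum_option
        (α := Σ i : Fin n, (c i).Vertex)
        (fun w => planeDiff a (PlaneTree.graftAt t (.node n c) w))
    have h2 : ∀ i, ∀ w : (c i).Vertex,
        planeDiff a (.node n (Function.update c i (PlaneTree.graftAt t (c i) w))) =
          brace a n (Function.update (fun j => planeDiff a (c j)) i
            (planeDiff a (PlaneTree.graftAt t (c i) w))) := by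
      intro i w
      rw [planeDiff]
      congr 1
      funext j
      by_cases h : j = i
      · subst h; simp
      · simp [h]
    have h3 : planeDiff a (.node (n + 1) (Fin.cons t c)) =
        brace a (n + 1) (Fin.cons (planeDiff a t) fun j => planeDiff a (c j)) := by
      rw [planeDiff]
      congr 1
      funext j
      refine Fin.cases ?_ (fun j => ?_) j <;> simp
    simp only [h1, h2, h3, ← brace_update_sum, sum_planeDiff_graftAt a t, brace_cons]
    rw [sub_add_cancel, planeDiff]

end PreLie

section UniversalProperty

variable (k : Type*) [Field k] {A : Type*} [LeftPreLieRing A] [LeftPreLieAlgebra k A]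

/-- `F : T → A` is a morphism of pre-Lie algebras that maps the one-vertex tree to `a`. -/
def IsTreeMorphism (a : A) (F : TreeSpace k →ₗ[k] A) : Prop :=
  (∀ x y, F (TreeSpace.graft k x y) = F x * F y) ∧ F (TreeSpace.tree k RTree.leaf) = a

variable {k} in
open TreeSpace in
theorem treeMorphism_ext {a : A} {F G : TreeSpace k →ₗ[k] A} (hF : IsTreeMorphism k a F)
    (hG : IsTreeMorphism k a G) : F = G := by
  have key : ∀ (N n : ℕ) (c : Fin n → PlaneTree), (PlaneTree.node n c).order = N →
      F (tree k (RTree.mk (.node n c))) = G (tree k (RTree.mk (.node n c))) := by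
    intro N
    induction N using Nat.strong_induction_on with
    | _ N ihN =>
    intro n
    induction n with
    | zero =>
      intro c _
      have : RTree.mk (.node 0 c) = RTree.leaf :=
        RTree.mk_node (Equiv.refl _) fun i => i.elim0
      rw [this, hF.2, hG.2]
    | succ n ih =>
      intro c hc
      rw [← Fin.cons_self_tail c] at hc ⊢
      generalize c 0 = t at hc ⊢
      generalize Fin.tail c = d at hc ⊢
      have hsum : ∀ H : TreeSpace k →ₗ[k] A, IsTreeMorphism k a H →
          H (tree k (RTree.mk t)) * H (tree k (RTree.mk (.node n d))) =
            H (tree k (RTree.mk (.node (n + 1) (Fin.cons t d)))) +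
              ∑ i, ∑ w : (d i).Vertex, H (tree k (RTree.mk
                (.node n (Function.update d i (PlaneTree.graftAt t (d i) w))))) := by
        intro H hH
        rw [← hH.1, graft_mk, map_sum, ← Fintype.sum_sigma']
        exact Fintype.sum_option (α := Σ i : Fin n, (d i).Vertex)
          (fun w => H (tree k (RTree.mk (PlaneTree.graftAt t (.node n d) w))))
      have hord : t.order + (PlaneTree.node n d).order = N := by
        rw [← hc, PlaneTree.order_node, PlaneTree.order_node, Fin.sum_univ_succ]
        simp only [Fin.cons_zero, Fin.cons_succ]
        omega
      have ht : F (tree k (RTree.mk t)) = G (tree k (RTree.mk t)) := by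
        rcases t with ⟨m, b⟩
        refine ihN _ ?_ m b rfl
        rw [PlaneTree.order_node n] at hord
        omega
      have hu : F (tree k (RTree.mk (.node n d))) = G (tree k (RTree.mk (.node n d))) := by
        refine ihN _ ?_ n d rfl
        rcases t with ⟨m, b⟩
        rw [PlaneTree.order_node m] at hord
        omega
      have hrest : ∀ i, ∀ w : (d i).Vertex,
          F (tree k (RTree.mk (.node n (Function.update d i (PlaneTree.graftAt t (d i) w))))) =
          G (tree k (RTree.mk
            (.node n (Function.update d i (PlaneTree.graftAt t (d i) w))))) := by
        intro i w
        refine ih _ ?_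
        rw [← hord]
        exact PlaneTree.order_graftAt t (.node n d) (some ⟨i, w⟩)
      have h1 := hsum F hF
      have h2 := hsum G hG
      simp only [ht, hu, hrest] at h1
      exact add_right_cancel (h1.symm.trans h2)
  ext t
  have := RTree.mk_rep t
  rcases h : t.rep with ⟨n, c⟩
  rw [h] at this
  subst this
  exact key _ n c rfl

open TreeSpace in
/-- The space of rooted trees is the free left pre-Lie algebra on the one-vertex tree. -/
theorem existsUnique_treeMorphism (a : A) :
    ∃! F : TreeSpace k →ₗ[k] A, IsTreeMorphism k a F := by
  refine existsUnique_of_exists_of_unique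
    ⟨Finsupp.linearCombination k fun t : RTree => planeDiff a t.rep, ?_, ?_⟩
    fun F G hF hG => treeMorphism_ext hF hG
  · have hmk : ∀ p, Finsupp.linearCombination k (fun t : RTree => planeDiff a t.rep)
        (tree k (RTree.mk p)) = planeDiff a p := by
      intro p
      simp only [tree, Finsupp.linearCombination_single, one_smul]
      exact planeDiff_iso a _ _ (RTree.mk_eq_mk.1 (RTree.mk_rep _))
    generalize Finsupp.linearCombination k (fun t : RTree => planeDiff a t.rep) = F at hmk
    have : (graft k).compr₂ F = (LinearMap.mul k A).compl₁₂ F F := by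
      ext t u
      have ht := RTree.mk_rep t
      have hu := RTree.mk_rep u
      change F (graft k (tree k t) (tree k u)) = F (tree k t) * F (tree k u)
      rw [← ht, ← hu, graft_mk, map_sum]
      simp only [hmk, sum_planeDiff_graftAt]
    intro x y
    exact LinearMap.congr_fun₂ this x y
  · simp only [tree, Finsupp.linearCombination_single, one_smul]
    rw [planeDiff_iso a _ _ (RTree.mk_eq_mk.1 (RTree.mk_rep RTree.leaf))]
    rfl

end UniversalProperty

/-! ### The pre-Lie algebra `A[[h]]` -/

section FormalSeries

variable {A : Type*}

theorem FormalSeries.coeff_mul [NonUnitalNonAssocRing A] (x y : HahnSeries ℕ A)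
    (n : ℕ) : (x * y).coeff n = ∑ p ∈ Finset.HasAntidiagonal.antidiagonal n, x.coeff p.1 * y.coeff p.2 := by
  rw [HahnSeries.coeff_mul]
  refine Finset.sum_subset (fun p hp => ?_) (fun p hp hp' => ?_)
  · exact Finset.HasAntidiagonal.mem_antidiagonal.2 (Finset.mem_antidiagonal.1 hp).2.2
  · by_contra hne
    refine hp' (Finset.mem_antidiagonal.2
      ⟨?_, ?_, Finset.HasAntidiagonal.mem_antidiagonal.1 hp⟩)
    · exact fun h0 => hne (by rw [h0, zero_mul])
    · exact fun h0 => hne (by rw [h0, mul_zero])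

/-- Formal power series with coefficients in a left pre-Lie ring, with the product extended
`h`-linearly, form a left pre-Lie ring. -/
noncomputable instance FormalSeries.leftPreLieRing [LeftPreLieRing A] : LeftPreLieRing (HahnSeries ℕ A) where
  assoc_symm' x y z := by
    have key : ∀ x y z : HahnSeries ℕ A, ∀ n, (associator x y z).coeff n =
        ∑ p ∈ Finset.HasAntidiagonal.antidiagonal n, ∑ q ∈ Finset.HasAntidiagonal.antidiagonal p.1,
          associator (x.coeff q.1) (y.coeff q.2) (z.coeff p.2) := by
      intro x y z n
      have h : (x * (y * z)).coeff n =
          ∑ p ∈ Finset.HasAntidiagonal.antidiagonal n, ∑ q ∈ Finset.HasAntidiagonal.antidiagonal p.1,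
            x.coeff q.1 * (y.coeff q.2 * z.coeff p.2) := by
        simp only [FormalSeries.coeff_mul, Finset.mul_sum, Finset.sum_sigma']
        refine Finset.sum_nbij' (fun s => ⟨(s.1.1 + s.2.1, s.2.2), (s.1.1, s.2.1)⟩)
          (fun s => ⟨(s.2.1, s.2.2 + s.1.2), (s.2.2, s.1.2)⟩) ?_ ?_ ?_ ?_ ?_
        · rintro ⟨⟨a, b⟩, ⟨c, d⟩⟩ h
          simp at h ⊢; omega
        · rintro ⟨⟨a, b⟩, ⟨c, d⟩⟩ h
          simp at h ⊢; omega
        · rintro ⟨⟨a, b⟩, ⟨c, d⟩⟩ h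
          simp at h ⊢; omega
        · rintro ⟨⟨a, b⟩, ⟨c, d⟩⟩ h
          simp at h ⊢; omega
        · rintro ⟨⟨a, b⟩, ⟨c, d⟩⟩ h
          rfl
      rw [associator_apply, HahnSeries.coeff_sub, h]
      simp only [FormalSeries.coeff_mul, Finset.sum_mul, ← Finset.sum_sub_distrib,
        associator_apply]
    ext n
    rw [key, key]
    refine Finset.sum_congr rfl fun p _ => ?_
    rw [← Finset.Nat.sum_antidiagonal_swap]
    exact Finset.sum_congr rfl fun q _ => LeftPreLieRing.assoc_symm _ _ _

noncomputable instance FormalSeries.leftPreLieAlgebra {k : Type*} [CommRing k] [LeftPreLieRing A]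
    [LeftPreLieAlgebra k A] : LeftPreLieAlgebra k (HahnSeries ℕ A) where
  smul_assoc r x y := by
    ext n
    simp [FormalSeries.coeff_mul, Finset.smul_sum, smul_mul_assoc]
  smul_comm r x y := by
    ext n
    simp [FormalSeries.coeff_mul, Finset.smul_sum, mul_smul_comm]

/-- The formal power series `∑ n, h ^ n * c n`. -/
def formalSeries [Zero A] (c : ℕ → A) : HahnSeries ℕ A where
  coeff := c
  isPWO_support' := Set.IsWF.isPWO (Set.IsWF.of_wellFoundedLT _)

@[simp]
theorem coeff_formalSeries [Zero A] (c : ℕ → A) (n : ℕ) : (formalSeries c).coeff n = c n := rfl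

/-- Division by `h`: on the space `h A[[h]]` of the series without constant term, this is the
inverse of the multiplication by `h`. -/
def divH [Zero A] (x : HahnSeries ℕ A) : HahnSeries ℕ A := formalSeries fun n => x.coeff (n + 1)

end FormalSeries

/-! ### The bialgebra of rooted forests -/

section Forests

variable (k : Type*) [Field k]

/-- The symmetric algebra `S(T)`, with basis the rooted forests: it is the common underlying algebra
of the bialgebra `H̃` and of the Connes–Kreimer Hopf algebra. The unit is the empty forest. -/
abbrev ForestAlgebra : Type _ := MvPolynomial RTree k

namespace ForestAlgebra

open scoped TensorProduct

/-- The product of the trees of a forest. -/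
noncomputable def forest (s : Multiset PlaneTree) : ForestAlgebra k :=
  (s.map fun p => MvPolynomial.X (RTree.mk p)).prod

/-- The coproduct of `H̃` on a tree: the sum over the spanning subforests `s` of `t` of
`s ⊗ t / s`. -/
noncomputable def treeCoproduct (t : RTree) : ForestAlgebra k ⊗[k] ForestAlgebra k :=
  ∑ s : PlaneTree.SpanningSubforest t.rep,
    forest k (PlaneTree.components t.rep s) ⊗ₜ[k]
      MvPolynomial.X (RTree.mk (PlaneTree.contract t.rep s))

/-- The coproduct of `H̃`, the multiplicative extension of `treeCoproduct`. It is also the left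
coaction of `H̃` on the Connes–Kreimer Hopf algebra. -/
noncomputable def coproduct : ForestAlgebra k →ₐ[k] ForestAlgebra k ⊗[k] ForestAlgebra k :=
  MvPolynomial.aeval (treeCoproduct k)

variable {k}

/-- The convolution product `φ ⋆ ψ = m ∘ (φ ⊗ ψ) ∘ Δ` for the coproduct of `H̃`. -/
noncomputable def convolution (φ ψ : ForestAlgebra k →ₗ[k] k) : ForestAlgebra k →ₗ[k] k :=
  LinearMap.mul' k k ∘ₗ TensorProduct.map φ ψ ∘ₗ (coproduct k).toLinearMap

/-- The multiplicative extension to forests of a linear form on `T`. -/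
noncomputable def character (α : Module.Dual k (TreeSpace k)) : ForestAlgebra k →ₐ[k] k :=
  MvPolynomial.aeval fun t => α (TreeSpace.tree k t)

/-- The infinitesimal character that extends a linear form on `T`: it vanishes on the empty forest
and on the forests with at least two trees. -/
noncomputable def infinitesimalCharacter (β : Module.Dual k (TreeSpace k)) :
    ForestAlgebra k →ₗ[k] k :=
  (MvPolynomial.basisMonomials RTree k).constr k fun m =>
    if m.degree = 1 then ∑ t ∈ m.support, β (TreeSpace.tree k t) else 0

theorem infinitesimalCharacter_monomial (β : Module.Dual k (TreeSpace k)) (m : RTree →₀ ℕ) :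
    infinitesimalCharacter β (MvPolynomial.monomial m 1) =
      if m.degree = 1 then ∑ t ∈ m.support, β (TreeSpace.tree k t) else 0 := by
  rw [show MvPolynomial.monomial m (1 : k) = MvPolynomial.basisMonomials RTree k m by simp,
    infinitesimalCharacter, Module.Basis.constr_basis]

theorem infinitesimalCharacter_X (β : Module.Dual k (TreeSpace k)) (t : RTree) :
    infinitesimalCharacter β (MvPolynomial.X t) = β (TreeSpace.tree k t) := by
  rw [MvPolynomial.X, infinitesimalCharacter_monomial, if_pos (by simp),
    Finsupp.support_single _ one_ne_zero, Finset.sum_singleton]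

theorem infinitesimalCharacter_mul (β : Module.Dual k (TreeSpace k)) (x y : ForestAlgebra k) :
    infinitesimalCharacter β (x * y) =
      infinitesimalCharacter β x * MvPolynomial.constantCoeff y +
        MvPolynomial.constantCoeff x * infinitesimalCharacter β y := by
  classical
  induction x using MvPolynomial.induction_on' with
  | add p q hp hq => simp only [add_mul, map_add, hp, hq]; ring
  | monomial m r =>
  induction y using MvPolynomial.induction_on' with
  | add p q hp hq => simp only [mul_add, map_add, hp, hq]; ring
  | monomial l u =>
  have hr : ∀ (m : RTree →₀ ℕ) (r : k), infinitesimalCharacter β (MvPolynomial.monomial m r) =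
      r * infinitesimalCharacter β (MvPolynomial.monomial m 1) := by
    intro m r
    rw [← smul_eq_mul, ← map_smul, MvPolynomial.smul_monomial, smul_eq_mul, mul_one]
  rw [MvPolynomial.monomial_mul, hr, hr m, hr l, MvPolynomial.constantCoeff_monomial,
    MvPolynomial.constantCoeff_monomial]
  simp only [infinitesimalCharacter_monomial]
  by_cases hm : m = 0
  · by_cases hl : l = 0
    · simp [hm, hl]
    · simp [hm, hl, mul_assoc]
  · by_cases hl : l = 0
    · simp [hm, hl, mul_left_comm, mul_assoc, mul_comm]
    · have h1 : m.degree ≠ 0 := fun h => hm ((Finsupp.degree_eq_zero_iff m).1 h)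
      have h2 : l.degree ≠ 0 := fun h => hl ((Finsupp.degree_eq_zero_iff l).1 h)
      have h3 : (m + l).degree ≠ 1 := by
        rw [map_add]; omega
      rw [if_neg h3, if_neg hm, if_neg hl]
      ring

/-- The restriction of a linear form on forests to a linear form on `T ⊕ k∅`, where `∅` is the
empty forest. -/
noncomputable def restrict (φ : ForestAlgebra k →ₗ[k] k) : Module.Dual k (TreeSpace k × k) :=
  φ ∘ₗ LinearMap.coprod (Finsupp.linearCombination k MvPolynomial.X)
    (Algebra.linearMap k (ForestAlgebra k))

end ForestAlgebra

end Forests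

/-! ### B-series -/

section BSeries

variable {k : Type*} [Field k] {A : Type*} [LeftPreLieRing A] [LeftPreLieAlgebra k A]

variable (k) in
/-- The morphism of pre-Lie algebras `F_a : T → A` that maps the one-vertex tree to `a`. -/
noncomputable def elementaryDifferential (a : A) : TreeSpace k →ₗ[k] A :=
  (existsUnique_treeMorphism k a).choose

variable (k) in
theorem elementaryDifferential_spec (a : A) :
    IsTreeMorphism k a (elementaryDifferential k a) :=
  (existsUnique_treeMorphism k a).choose_spec.1

/-- The weight `γ(t) / σ(t)` of a tree in a B-series. -/
noncomputable def bWeight (γ : Module.Dual k (TreeSpace k × k)) (t : RTree) : k :=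
  γ (TreeSpace.tree k t, 0) / (t.symmetryFactor : k)

/-- The B-series `B(γ; a) = γ(∅) 𝟏 + ∑ t, h ^ v(t) γ(t) / σ(t) F_a(t)` of an element `a` of `A`,
for a linear form `γ` on `T ⊕ k∅`. The first component is the coefficient of `𝟏`. -/
noncomputable def bSeries (γ : Module.Dual k (TreeSpace k × k)) (a : A) : k × HahnSeries ℕ A :=
  (γ (0, 1), formalSeries fun n => ∑ t ∈ RTree.ofOrder n,
    bWeight γ t • elementaryDifferential k a (TreeSpace.tree k t))

/-- The B-series `B(γ; x)` of a formal series `x ∈ A[[h]]`, with the same parameter `h`: the sum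
`γ(∅) 𝟏 + ∑ t, h ^ v(t) γ(t) / σ(t) F_x(t)`, where `F_x(t) ∈ A[[h]]`, which converges in the
`h`-adic topology. -/
noncomputable def formalBSeries (γ : Module.Dual k (TreeSpace k × k)) (x : HahnSeries ℕ A) :
    k × HahnSeries ℕ A :=
  (γ (0, 1), formalSeries fun n => ∑ m ∈ Finset.range (n + 1), ∑ t ∈ RTree.ofOrder m,
    bWeight γ t • (elementaryDifferential k x (TreeSpace.tree k t)).coeff (n - m))

theorem coeff_zero_bSeries (γ : Module.Dual k (TreeSpace k × k)) (a : A) :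
    (bSeries γ a).2.coeff 0 = 0 := by
  have : RTree.ofOrder 0 = ∅ := by
    refine Finset.eq_empty_of_forall_notMem fun t ht => ?_
    have h : t.rep.order = 0 := RTree.mem_ofOrder.1 ht
    rcases h' : t.rep with ⟨n, c⟩
    rw [h', PlaneTree.order_node] at h
    omega
  simp [bSeries, this]

/-- The extension by `0` on `∅` of a linear form on `T`. -/
noncomputable def extendByZero (α : Module.Dual k (TreeSpace k)) :
    Module.Dual k (TreeSpace k × k) :=
  α ∘ₗ LinearMap.fst k (TreeSpace k) k

end BSeries

open scoped TensorProduct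

/-! ### Linearity and functoriality of braces -/

section BraceLinear

variable {A B : Type*} [LeftPreLieRing A] [LeftPreLieRing B]

/-! The coefficient of h^n can be read over K = k[h]/(h^(n+1)), so the proof works over a ring K
with a nilpotent parameter h. The weights of the plane representatives of t add up to 1/σ(t)
(`PlaneTree.sum_weight_mul_card_iso`), so B-series become weighted sums over plane trees. On these,
F_x is a symmetric brace of the values on the branches, and recursion on the branches becomes a
fixed point equation (`planeSeries_eq`).

Write E_y(b) = ∑ b{y, …, y}/n! (`braceExp`) and J for joining a forest to a new root. The series Z =
∑ t ⊗ F_{hx}(t)/σ(t), with the trees themselves as coefficients, satisfies Z = J(E_Z(hx)). Let hx be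
the α-series of a, let U be the analogue of Z for ha, and put V = E_Z(U), where the trees coming
from U are of a first kind and those from Z of a second kind. Evaluating the first kind by α turns U
into hx, hence V into E_Z(hx); joining the second kind then gives Z.

On the other hand, U = J(E_U(ha)) and the group law E_y E_u = E_{y + E_y(u)} (`braceExp_braceExp`)
give V = J(E_{Z+V}(ha)), with J joining the first kind. As Z is obtained from V by evaluation and
joining, this reads V = J(E_{ΛV}(ha)) with Λ = id + (evaluation by α, then joining). The sum over
spanning subforests obeys the same recursion (`subforestSum_node`): an edge at the root is either
kept, so that the root component of the branch grows the one above it, or cut, so that this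
component is evaluated by α and the contracted branch becomes a tree of the second kind. The
equation is contracting in the h-adic sense, so its solution is unique
(`braceExp_fixedPoint_unique`). Evaluating, joining and applying β to V in its two descriptions
gives the two sides of the theorem (`sum_planeDiff_substitution`).

The group law itself comes from a differential equation: with y replaced by sy, both sides solve the
same linear equation f' = (hz) f with the same value at s = 0. -/

theorem brace_update_smul {K : Type*} [CommRing K] [LeftPreLieAlgebra K A] (a : A) :
    ∀ (n : ℕ) (v : Fin n → A) (j : Fin n) (r : K) (x : A),
      brace a n (Function.update v j (r • x)) = r • brace a n (Function.update v j x) := by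
  intro n
  induction n with
  | zero => intro v j; exact j.elim0
  | succ n ih =>
    intro v j r x
    rw [← Fin.cons_self_tail v]
    generalize v 0 = z
    generalize Fin.tail v = u
    refine Fin.cases ?_ (fun j => ?_) j
    · simp only [Fin.update_cons_zero, brace_cons, smul_mul_assoc, ih, ← Finset.smul_sum, smul_sub]
    · simp only [← Fin.cons_update, brace_cons, ih, mul_smul_comm]
      have : ∀ i, brace a n (Function.update (Function.update u j (r • x)) i
            (z * Function.update u j (r • x) i)) =
          r • brace a n (Function.update (Function.update u j x) i
            (z * Function.update u j x i)) := by
        intro i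
        by_cases h : i = j
        · subst h; simp [mul_smul_comm, ih]
        · simp only [Function.update_of_ne h, Function.update_comm (Ne.symm h), ih]
      simp only [this, ← Finset.smul_sum, smul_sub]

/-- The symmetric brace as a multilinear map. -/
def braceMultilinear (K : Type*) [CommRing K] [LeftPreLieAlgebra K A] (a : A) (n : ℕ) :
    MultilinearMap K (fun _ : Fin n => A) A where
  toFun := brace a n
  map_update_add' {inst} v j x y := by
    convert brace_update_add a n v j x y
  map_update_smul' {inst} v j r x := by
    convert brace_update_smul a n v j r x

theorem brace_smul_univ {K : Type*} [CommRing K] [LeftPreLieAlgebra K A] (a : A) (n : ℕ)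
    (r : Fin n → K) (v : Fin n → A) :
    brace a n (fun i => r i • v i) = (∏ i, r i) • brace a n v :=
  (braceMultilinear K a n).map_smul_univ r v

theorem brace_sum_finset {K : Type*} [CommRing K] [LeftPreLieAlgebra K A] (a : A) (n : ℕ)
    {ι : Type*} (s : Finset ι) (g : ι → A) :
    brace a n (fun _ => ∑ j ∈ s, g j) =
      ∑ c ∈ Fintype.piFinset fun _ : Fin n => s, brace a n (fun i => g (c i)) :=
  (braceMultilinear K a n).map_sum_finset (fun _ => g) (fun _ => s)

theorem brace_smul_left {K : Type*} [CommRing K] [LeftPreLieAlgebra K A] (r : K) (a : A) :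
    ∀ (n : ℕ) (v : Fin n → A), brace (r • a) n v = r • brace a n v := by
  intro n
  induction n with
  | zero => intro v; rfl
  | succ n ih =>
    intro v
    simp only [brace, ih, mul_smul_comm, smul_sub, Finset.smul_sum]

theorem map_brace (φ : A →ₙ+* B) (a : A) : ∀ (n : ℕ) (v : Fin n → A),
    φ (brace a n v) = brace (φ a) n (φ ∘ v) := by
  intro n
  induction n with
  | zero => intro v; rfl
  | succ n ih =>
    intro v
    simp only [brace, map_sub, map_mul, map_sum, ih, Function.comp_update]
    rfl

theorem map_planeDiff (φ : A →ₙ+* B) (a : A) : ∀ p : PlaneTree,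
    φ (planeDiff a p) = planeDiff (φ a) p
  | .node n c => by
    rw [planeDiff, planeDiff, map_brace]
    congr 1
    funext i
    exact map_planeDiff φ a (c i)

/-- Every vertex contributes one factor `a`. With a nilpotent scalar this kills all large trees, so
finite sums over trees suffice. -/
theorem planeDiff_smul {K : Type*} [CommRing K] [LeftPreLieAlgebra K A] (r : K) (a : A) :
    ∀ p : PlaneTree, planeDiff (r • a) p = r ^ p.order • planeDiff a p
  | .node n c => by
    have h : (fun i => planeDiff (r • a) (c i)) =
        fun i => r ^ (c i).order • planeDiff a (c i) :=
      funext fun i => planeDiff_smul r a (c i)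
    rw [planeDiff, planeDiff, h, brace_smul_univ, brace_smul_left, smul_smul,
      PlaneTree.order_node, pow_succ, Finset.prod_pow_eq_pow_sum]

/-- The recursion for the brace involves only products, so the Leibniz rule propagates: the terms
where `D z` acts on an entry recombine with `D z * brace a n u` into the brace with first entry `D
z`. -/
theorem derivation_brace (D : A →+ A) (hD : ∀ x y, D (x * y) = D x * y + x * D y) (a : A) :
    ∀ (n : ℕ) (v : Fin n → A),
      D (brace a n v) = brace (D a) n v + ∑ i, brace a n (Function.update v i (D (v i))) := by
  intro n
  induction n with
  | zero => intro v; simp [brace]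
  | succ n ih =>
    intro v
    rw [← Fin.cons_self_tail v]
    generalize v 0 = z
    generalize Fin.tail v = u
    rw [Fin.sum_univ_succ]
    simp only [Fin.cons_zero, Fin.cons_succ, Fin.update_cons_zero, ← Fin.cons_update, brace_cons,
      map_sub, hD, map_sum, ih, mul_add, Finset.mul_sum, Finset.sum_sub_distrib,
      Finset.sum_add_distrib]
    -- In slot `i` the Leibniz rule splits `D (z * u i)` in two; in the other slots, applying `D`
    -- commutes with multiplying slot `i` by `z`.
    have key : ∀ i, ∑ j, brace a n (Function.update (Function.update u i (z * u i)) j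
          (D (Function.update u i (z * u i) j))) =
        brace a n (Function.update u i (D z * u i)) +
          ∑ j, brace a n (Function.update (Function.update u j (D (u j))) i
            (z * Function.update u j (D (u j)) i)) := by
      intro i
      rw [← Finset.add_sum_erase _ _ (Finset.mem_univ i),
        ← Finset.add_sum_erase _ _ (Finset.mem_univ i), ← add_assoc]
      congr 1
      · simp [hD, brace_update_add]
      · refine Finset.sum_congr rfl fun j hj => ?_
        have hj := Finset.ne_of_mem_erase hj
        rw [Function.update_of_ne hj, Function.update_of_ne hj.symm, Function.update_comm hj]
    simp only [key, Finset.sum_add_distrib]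
    rw [Finset.sum_comm (f := fun i j => brace a n
      (Function.update (Function.update u j (D (u j))) i (z * Function.update u j (D (u j)) i)))]
    abel

end BraceLinear

/-! ### Extension of scalars -/

section BaseChange

variable {K R A : Type*} [CommRing K] [CommRing R] [Algebra K R] [LeftPreLieRing A]
  [LeftPreLieAlgebra K A]

noncomputable instance TensorProduct.leftPreLieRing : LeftPreLieRing (R ⊗[K] A) where
  assoc_symm' x y z := by
    induction x using TensorProduct.induction_on with
    | zero => simp [associator_apply]
    | add x x' hx hx' =>
      simp only [associator_apply, add_mul, mul_add] at hx hx' ⊢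
      rw [add_sub_add_comm, hx, hx']; abel
    | tmul r a =>
    induction y using TensorProduct.induction_on with
    | zero => simp [associator_apply]
    | add x x' hx hx' =>
      simp only [associator_apply, add_mul, mul_add] at hx hx' ⊢
      rw [add_sub_add_comm, hx, hx']; abel
    | tmul s b =>
    induction z using TensorProduct.induction_on with
    | zero => simp [associator_apply]
    | add x x' hx hx' =>
      simp only [associator_apply, mul_add] at hx hx' ⊢
      rw [add_sub_add_comm, hx, hx']; abel
    | tmul t c =>
      simp only [associator_apply, Algebra.TensorProduct.tmul_mul_tmul]
      rw [← mul_assoc, ← mul_assoc, mul_comm s r, ← TensorProduct.tmul_sub,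
        ← TensorProduct.tmul_sub, ← associator_apply, ← associator_apply,
        LeftPreLieRing.assoc_symm]

noncomputable instance TensorProduct.leftPreLieAlgebra : LeftPreLieAlgebra K (R ⊗[K] A) where

variable (K R) in
/-- The inclusion `a ↦ 1 ⊗ a`. -/
noncomputable def tensorIncl : A →ₙ+* R ⊗[K] A where
  toFun a := 1 ⊗ₜ a
  map_zero' := TensorProduct.tmul_zero _ _
  map_add' := TensorProduct.tmul_add _
  map_mul' a b := by rw [Algebra.TensorProduct.tmul_mul_tmul, one_mul]

theorem tensorIncl_apply (a : A) : tensorIncl K R a = 1 ⊗ₜ a := rfl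

variable (A) in
/-- The morphism `f ⊗ id` induced by a morphism `f` of algebras. -/
noncomputable def tensorMap {R' : Type*} [CommRing R'] [Algebra K R'] (f : R →ₐ[K] R') :
    R ⊗[K] A →ₙ+* R' ⊗[K] A where
  toFun := f.toLinearMap.rTensor A
  map_zero' := map_zero _
  map_add' := map_add _
  map_mul' x y := by
    induction x using TensorProduct.induction_on with
    | zero => simp
    | add x x' hx hx' => simp only [add_mul, map_add, hx, hx']
    | tmul r a =>
    induction y using TensorProduct.induction_on with
    | zero => simp
    | add x x' hx hx' => simp only [mul_add, map_add, hx, hx']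
    | tmul s b => simp [Algebra.TensorProduct.tmul_mul_tmul]

theorem tensorMap_tmul {R' : Type*} [CommRing R'] [Algebra K R'] (f : R →ₐ[K] R') (r : R) (a : A) :
    tensorMap A f (r ⊗ₜ a) = f r ⊗ₜ a := rfl

theorem tensorIncl_smul (r : K) (a : A) :
    tensorIncl K R (r • a) = r • tensorIncl K R a := by
  simp [tensorIncl_apply]

theorem tensorMap_smul {R' : Type*} [CommRing R'] [Algebra K R']
    (f : R →ₐ[K] R') (r : K) (x : R ⊗[K] A) : tensorMap A f (r • x) = r • tensorMap A f x :=
  map_smul (f.toLinearMap.rTensor A) r x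

theorem tensorIncl_self_injective : Function.Injective (tensorIncl K K : A →ₙ+* K ⊗[K] A) := by
  intro x y hxy
  have := congrArg (TensorProduct.lid K A) hxy
  simpa [tensorIncl_apply] using this

theorem brace_tmul (r : R) (a : A) : ∀ (n : ℕ) (s : Fin n → R) (v : Fin n → A),
    brace (r ⊗ₜ[K] a) n (fun i => s i ⊗ₜ v i) = (r * ∏ i, s i) ⊗ₜ brace a n v := by
  intro n
  induction n with
  | zero => intro s v; simp [brace]
  | succ n ih =>
    intro s v
    simp only [brace]
    have h : ∀ i : Fin n, Function.update (Fin.tail fun i => s i ⊗ₜ[K] v i) i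
        ((s 0 ⊗ₜ v 0) * Fin.tail (fun i => s i ⊗ₜ[K] v i) i) =
        fun j => (Function.update (Fin.tail s) i (s 0 * Fin.tail s i) j) ⊗ₜ
          (Function.update (Fin.tail v) i (v 0 * Fin.tail v i) j) := by
      intro i
      funext j
      by_cases hj : j = i
      · subst hj
        simp [Fin.tail, Algebra.TensorProduct.tmul_mul_tmul]
      · simp [hj, Fin.tail]
    -- The scalar `s 0` moves into slot `i` without changing the product, so all the terms of the
    -- recursion carry the same scalar.
    have hp : ∀ i : Fin n, ∏ j, Function.update (Fin.tail s) i (s 0 * Fin.tail s i) j =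
        ∏ j, s j := by
      intro i
      rw [Finset.prod_update_of_mem (Finset.mem_univ i), mul_assoc, Fin.prod_univ_succ,
        ← Finset.mul_prod_erase _ _ (Finset.mem_univ i), Finset.sdiff_singleton_eq_erase]
      rfl
    simp only [h, ih, hp]
    rw [show (Fin.tail fun i => s i ⊗ₜ[K] v i) = fun i => Fin.tail s i ⊗ₜ[K] Fin.tail v i from rfl,
      ih, Algebra.TensorProduct.tmul_mul_tmul, TensorProduct.tmul_sub, TensorProduct.tmul_sum]
    congr 2
    rw [Fin.prod_univ_succ, mul_left_comm]
    rfl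

end BaseChange

/-! ### The exponential of a pre-Lie algebra with a nilpotent parameter -/

section Replace

variable {K : Type*} [CommRing K] {L : Type*} [LeftPreLieRing L] [LeftPreLieAlgebra K L]

/-- The sum of the braces obtained by replacing one of the `n` entries `y` by `w`. -/
def braceReplace (b : L) (n : ℕ) (y w : L) : L :=
  ∑ i : Fin n, brace b n (Function.update (fun _ => y) i w)

theorem braceReplace_add (b : L) (n : ℕ) (y w w' : L) :
    braceReplace b n y (w + w') = braceReplace b n y w + braceReplace b n y w' := by
  simp only [braceReplace, brace_update_add, Finset.sum_add_distrib]

/-- By symmetry of the brace the replaced slot may be taken to be the first. The factor `n + 1` is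
what turns 1/(n+1)! into 1/n! in the exponential. -/
theorem braceReplace_succ (b : L) (n : ℕ) (y w : L) :
    braceReplace b (n + 1) y w = ((n + 1 : ℕ) : K) • brace b (n + 1) (Fin.cons w fun _ => y) := by
  have h : ∀ i : Fin (n + 1), brace b (n + 1) (Function.update (fun _ => y) i w) =
      brace b (n + 1) (Fin.cons w fun _ => y) := by
    intro i
    rw [← brace_perm b (n + 1) _ (Equiv.swap 0 i)]
    congr 1
    funext j
    refine Fin.cases ?_ (fun j => ?_) j
    · simp
    · by_cases hj : j.succ = i
      · subst hj
        rw [Function.comp_apply, Equiv.swap_apply_right,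
          Function.update_of_ne (Fin.succ_ne_zero j).symm, Fin.cons_succ]
      · rw [Function.comp_apply, Equiv.swap_apply_of_ne_of_ne (Fin.succ_ne_zero j) hj,
          Function.update_of_ne hj, Fin.cons_succ]
  rw [braceReplace, Finset.sum_congr rfl fun i _ => h i, Finset.sum_const, Finset.card_fin,
    Nat.cast_smul_eq_nsmul]

theorem mul_brace_const (b : L) (n : ℕ) (z y : L) :
    z * brace b n (fun _ => y) =
      brace b (n + 1) (Fin.cons z fun _ => y) + braceReplace b n y (z * y) := by
  rw [brace_cons, braceReplace, sub_add_cancel]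

variable {h : K} {N : ℕ}

theorem braceReplace_eq_zero (hN : h ^ N = 0) (b y w : L) :
    braceReplace b N (h • y) (h • w) = 0 := by
  refine Finset.sum_eq_zero fun i _ => ?_
  have : Function.update (fun _ => h • y) i (h • w) =
      fun j => h • Function.update (fun _ : Fin N => y) i w j := by
    funext j
    by_cases hj : j = i
    · subst hj; simp
    · simp [hj]
  rw [this, brace_smul_univ b N (fun _ => h)]
  simp [hN]

/-- Right multiplication by `h • y` is a nilpotent endomorphism, so adding it to the identity gives
an invertible one. -/
theorem exists_add_mul_eq (hN : h ^ N = 0) (y c : L) : ∃ z : L, z + z * (h • y) = c := by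
  let T : Module.End K L := h • LinearMap.mulRight K y
  have hT : IsNilpotent T := ⟨N, by rw [smul_pow, hN, zero_smul]⟩
  obtain ⟨e, he⟩ := hT.isUnit_one_add
  refine ⟨(↑e⁻¹ : Module.End K L) c, ?_⟩
  have := LinearMap.congr_fun (e.mul_inv) c
  rw [he] at this
  simpa [T, mul_smul_comm] using this

end Replace

section Exponential

/-- The inverse factorial in a `ℚ`-algebra. -/
noncomputable def invFactorial (K : Type*) [CommRing K] [Algebra ℚ K] (n : ℕ) : K :=
  algebraMap ℚ K ((n.factorial : ℚ)⁻¹)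

variable {K : Type*} [CommRing K] [Algebra ℚ K]

theorem invFactorial_zero : invFactorial K 0 = 1 := by simp [invFactorial]

theorem invFactorial_succ_mul (n : ℕ) :
    invFactorial K (n + 1) * ((n + 1 : ℕ) : K) = invFactorial K n := by
  rw [invFactorial, invFactorial, ← map_natCast (algebraMap ℚ K), ← map_mul]
  congr 1
  rw [Nat.factorial_succ]
  push_cast
  field_simp

variable {L M : Type*} [LeftPreLieRing L] [LeftPreLieAlgebra K L] [LeftPreLieRing M]
  [LeftPreLieAlgebra K M]

variable (K) in
/-- The truncated exponential `∑ n < N, 1 / n! b{y, …, y}` of right multiplication by `y`. -/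
noncomputable def braceExp (N : ℕ) (y b : L) : L :=
  ∑ n ∈ Finset.range N, invFactorial K n • brace b n fun _ => y

theorem map_braceExp (φ : L →ₙ+* M) (hφ : ∀ (r : K) x, φ (r • x) = r • φ x) (N : ℕ) (y b : L) :
    φ (braceExp K N y b) = braceExp K N (φ y) (φ b) := by
  simp only [braceExp, map_sum, hφ, map_brace]
  rfl

theorem braceExp_smul_right (N : ℕ) (y : L) (r : K) (b : L) :
    braceExp K N y (r • b) = r • braceExp K N y b := by
  simp only [braceExp, brace_smul_left, Finset.smul_sum, smul_comm r]

theorem braceExp_zero_left (N : ℕ) (hN : 0 < N) (b : L) : braceExp K N 0 b = b := by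
  obtain ⟨N, rfl⟩ : ∃ m, N = m + 1 := ⟨N - 1, by omega⟩
  rw [braceExp, Finset.sum_range_succ', invFactorial_zero, one_smul]
  have : ∀ n, brace b (n + 1) (fun _ => (0 : L)) = 0 := fun n =>
    (braceMultilinear K b (n + 1)).map_coord_zero (m := fun _ => 0) (0 : Fin (n + 1)) rfl
  simp only [this, smul_zero, Finset.sum_const_zero, zero_add]
  rfl

variable {h : K} {N : ℕ}

/-- Differentiating E_{hy}(b) replaces one entry by `h • z + (h • z) * (h • y)`. Multiplying b{hy,
…, hy} by `h • z` either adds an entry `h • z` or multiplies an existing entry by it. The second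
effects agree term by term, and the first ones after a shift of the index. -/
theorem derivation_braceExp (hN : h ^ N = 0) (D : L →+ L)
    (hD : ∀ x y, D (x * y) = D x * y + x * D y) (hDK : ∀ (r : K) x, D (r • x) = r • D x)
    (b y z : L) (hb : D b = 0) (hy : D (h • y) = h • z + (h • z) * (h • y)) :
    D (braceExp K N (h • y) b) = (h • z) * braceExp K N (h • y) b := by
  have hzero : ∀ n (v : Fin n → L), brace (0 : L) n v = 0 := fun n v => by
    simpa using brace_smul_left (0 : K) (0 : L) n v
  have h1 : ∀ n, D (brace b n fun _ => h • y) =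
      braceReplace b n (h • y) (h • z) + braceReplace b n (h • y) ((h • z) * (h • y)) := by
    intro n
    rw [derivation_brace D hD, hb, hzero, zero_add, ← braceReplace_add, ← hy, braceReplace]
  -- The shift would create a term of index `N`, but that term contains `h ^ N`; the term of index 0
  -- has no entry to replace.
  have h2 : ∑ n ∈ Finset.range N, invFactorial K n • braceReplace b n (h • y) (h • z) =
      ∑ n ∈ Finset.range N,
        invFactorial K n • brace b (n + 1) (Fin.cons (h • z) fun _ => h • y) := by
    have h3 := Finset.sum_range_succ
      (fun n => invFactorial K n • braceReplace b n (h • y) (h • z)) N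
    rw [braceReplace_eq_zero hN, smul_zero, add_zero, Finset.sum_range_succ'] at h3
    rw [← h3, show braceReplace b 0 (h • y) (h • z) = 0 from rfl, smul_zero, add_zero]
    refine Finset.sum_congr rfl fun n _ => ?_
    rw [braceReplace_succ (K := K), smul_smul, invFactorial_succ_mul]
  simp only [braceExp, map_sum, hDK, h1, Finset.mul_sum, mul_smul_comm, mul_brace_const, smul_add,
    Finset.sum_add_distrib, h2]

end Exponential

/-! ### The group law -/

section GroupLaw

open Polynomial

variable {K : Type*} [CommRing K]

section

variable [Algebra ℚ K]

/-- The antiderivative of a polynomial without constant term. -/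
noncomputable def antiderivative : K[X] →ₗ[K] K[X] :=
  (Polynomial.basisMonomials K).constr K fun n =>
    monomial (n + 1) (algebraMap ℚ K ((n : ℚ) + 1)⁻¹)

theorem antiderivative_monomial (n : ℕ) (r : K) :
    antiderivative (monomial n r) = monomial (n + 1) (algebraMap ℚ K ((n : ℚ) + 1)⁻¹ * r) := by
  rw [show monomial n r = r • monomial n (1 : K) by simp [smul_monomial], map_smul,
    show monomial n (1 : K) = Polynomial.basisMonomials K n by simp, antiderivative,
    Module.Basis.constr_basis, smul_monomial, smul_eq_mul, mul_comm]

theorem antiderivative_derivative (p : K[X]) :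
    antiderivative (derivative p) = p - C (aeval (0 : K) p) := by
  induction p using Polynomial.induction_on' with
  | add p q hp hq => simp only [map_add, hp, hq]; ring
  | monomial n r =>
    rcases n with _ | n
    · simp
    · rw [derivative_monomial, antiderivative_monomial, aeval_monomial]
      simp only [Nat.add_sub_cancel]
      rw [mul_left_comm, Nat.cast_succ,
        show ((n : K) + 1) = algebraMap ℚ K ((n : ℚ) + 1) by simp, ← map_mul,
        inv_mul_cancel₀ (by positivity)]
      simp

end

variable {L : Type*} [LeftPreLieRing L] [LeftPreLieAlgebra K L]

/-- The derivation of `K[X] ⊗ L` with respect to the variable. -/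
noncomputable def polyDeriv : K[X] ⊗[K] L →ₗ[K] K[X] ⊗[K] L :=
  (Polynomial.derivative (R := K)).rTensor L

theorem polyDeriv_mul (x y : K[X] ⊗[K] L) :
    polyDeriv (x * y) = polyDeriv x * y + x * polyDeriv y := by
  induction x using TensorProduct.induction_on with
  | zero => simp
  | add x x' hx hx' => simp only [add_mul, map_add, hx, hx']; abel
  | tmul r a =>
  induction y using TensorProduct.induction_on with
  | zero => simp
  | add x x' hx hx' => simp only [mul_add, map_add, hx, hx']; abel
  | tmul s b =>
    simp [polyDeriv, Algebra.TensorProduct.tmul_mul_tmul, TensorProduct.add_tmul]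

variable [Algebra ℚ K]

theorem antiderivative_polyDeriv (f : K[X] ⊗[K] L) :
    antiderivative.rTensor L (polyDeriv f) =
      f - (Algebra.linearMap K K[X]).rTensor L (tensorMap L (aeval (0 : K)) f) := by
  induction f using TensorProduct.induction_on with
  | zero => simp
  | add x x' hx hx' => simp only [map_add, hx, hx']; abel
  | tmul r a =>
    simp [polyDeriv, tensorMap_tmul, antiderivative_derivative, TensorProduct.sub_tmul]

/-- Integration from 0 turns the equation into f = h P(f) for a linear map P; iterating `N` times
gives a factor `h ^ N`. -/
theorem eq_zero_of_polyDeriv_eq {h : K} {N : ℕ} (hN : h ^ N = 0) (z f : K[X] ⊗[K] L)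
    (hf : polyDeriv f = (h • z) * f) (h0 : tensorMap L (aeval (0 : K)) f = 0) : f = 0 := by
  let P : Module.End K (K[X] ⊗[K] L) := antiderivative.rTensor L ∘ₗ LinearMap.mulLeft K z
  have hP : f = h • P f := by
    have := antiderivative_polyDeriv f
    rw [h0, map_zero, sub_zero, hf, smul_mul_assoc, map_smul] at this
    exact this.symm
  have hn : ∀ n, f = h ^ n • (P ^ n) f := by
    intro n
    induction n with
    | zero => simp
    | succ n ih =>
      rw [pow_succ, pow_succ, mul_smul, Module.End.mul_apply, ← map_smul, ← hP, ← ih]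
  rw [hn N, hN, zero_smul]

/-- Along the path `Y`, which is y times the polynomial variable, both sides solve the linear
equation of `eq_zero_of_polyDeriv_eq` with the same `z`. They agree at 0, and evaluation at 1 gives
the claim. -/
theorem braceExp_braceExp {h : K} {N : ℕ} (hN0 : 0 < N) (hN : h ^ N = 0) (y u a : L) :
    braceExp K N (h • y) (braceExp K N (h • u) a) =
      braceExp K N (h • y + braceExp K N (h • y) (h • u)) a := by
  let i : L →ₙ+* K[X] ⊗[K] L := tensorIncl K K[X]
  have hi : ∀ (r : K) x, i (r • x) = r • i x := tensorIncl_smul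
  let Y : K[X] ⊗[K] L := X ⊗ₜ y
  -- This `z` makes the constant velocity `h • i y` of the path equal to `h • z + (h • z) * (h •
  -- Y)`, as `derivation_braceExp` requires.
  obtain ⟨z, hz⟩ := exists_add_mul_eq hN Y (i y)
  have hDi : ∀ x, polyDeriv (i x) = 0 := fun x => by
    simp [i, tensorIncl_apply, polyDeriv]
  have hDY : polyDeriv (h • Y) = h • z + (h • z) * (h • Y) := by
    rw [smul_mul_assoc, ← smul_add, hz, map_smul]
    simp [Y, polyDeriv, i, tensorIncl_apply]
  have hD : ∀ (b x w : K[X] ⊗[K] L), polyDeriv b = 0 →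
      polyDeriv (h • x) = h • w + (h • w) * (h • x) →
      polyDeriv (braceExp K N (h • x) b) = (h • w) * braceExp K N (h • x) b :=
    fun b x w => derivation_braceExp hN (polyDeriv (K := K) (L := L)).toAddMonoidHom
      polyDeriv_mul (map_smul polyDeriv) b x w
  let V : K[X] ⊗[K] L := Y + braceExp K N (h • Y) (i u)
  have hV : h • V = h • Y + braceExp K N (h • Y) (h • i u) := by
    rw [smul_add, braceExp_smul_right]
  -- The combined exponent satisfies the same equation as `h • Y`, with the same `z`: the extra
  -- summand E_{hY}(hu) contributes its product with `h • z`.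
  have hDV : polyDeriv (h • V) = h • z + (h • z) * (h • V) := by
    rw [hV, map_add, hDY, hD (h • i u) Y z (by rw [map_smul, hDi, smul_zero]) hDY, mul_add,
      add_assoc]
  have hmap : ∀ (r : K) (x b : K[X] ⊗[K] L), tensorMap L (aeval r) (braceExp K N x b) =
      braceExp K N (tensorMap L (aeval r) x) (tensorMap L (aeval r) b) :=
    fun r => map_braceExp _ (tensorMap_smul _) N
  have hmi : ∀ (r : K) (x : L), tensorMap L (aeval r) (i x) = tensorIncl K K x := fun r x => by
    simp [i, tensorIncl_apply, tensorMap_tmul]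
  have hmY : ∀ r : K, tensorMap L (aeval r) Y = r • tensorIncl K K y := fun r => by
    simp [Y, tensorIncl_apply, tensorMap_tmul, TensorProduct.smul_tmul']
  have hzero : braceExp K N (h • Y) (braceExp K N (h • i u) (i a)) -
      braceExp K N (h • V) (i a) = 0 := by
    refine eq_zero_of_polyDeriv_eq hN z _ ?_ ?_
    · rw [map_sub, mul_sub, hD _ _ _ (hDi a) hDV, hD _ _ _ _ hDY]
      rw [← hi, ← map_braceExp i hi, hDi]
    · rw [map_sub, hV, hmap, hmap, hmap, map_add, hmap]
      simp only [tensorMap_smul, hmi, hmY, zero_smul, smul_zero, zero_add,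
        braceExp_zero_left N hN0, sub_self]
  have hone := congrArg (tensorMap L (aeval (1 : K))) (sub_eq_zero.1 hzero)
  rw [hV, hmap, hmap, hmap, map_add, hmap] at hone
  simp only [tensorMap_smul, hmi, hmY, one_smul, ← tensorIncl_smul] at hone
  have hj : ∀ x b : L, braceExp K N (tensorIncl K K x) (tensorIncl K K b) =
      tensorIncl K K (braceExp K N x b) := fun x b =>
    (map_braceExp (tensorIncl K K) tensorIncl_smul N x b).symm
  simp only [hj, ← map_add] at hone
  exact tensorIncl_self_injective hone

end GroupLaw

/-! ### Symmetry weights of plane trees -/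

namespace PlaneTree

/-- The weight `∏ v, 1 / n(v)!` of a plane tree, where `n(v)` is the number of children of the
vertex `v`. The weights of the plane trees in the class of `t` add up to `1 / σ(t)`. -/
def weight : PlaneTree → ℚ
  | node n c => (n.factorial : ℚ)⁻¹ * ∏ i, weight (c i)

theorem order_eq_of_iso : ∀ p q : PlaneTree, Nonempty (Iso p q) → p.order = q.order
  | node n c, node m d, ⟨⟨e, f⟩⟩ => by
    rw [order_node, order_node]
    have h : ∑ i, order (c i) = ∑ j, order (d j) := Fintype.sum_equiv e _ _
      fun i => order_eq_of_iso (c i) (d (e i)) ⟨f i⟩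
    rw [h]

theorem card_iso_node {n m : ℕ} (c : Fin n → PlaneTree) (d : Fin m → PlaneTree) :
    Nat.card (Iso (node n c) (node m d)) =
      ∑ e : Fin n ≃ Fin m, ∏ i, Nat.card (Iso (c i) (d (e i))) := by
  change Nat.card (Σ e : Fin n ≃ Fin m, ∀ i, Iso (c i) (d (e i))) = _
  rw [Nat.card_sigma]
  exact Finset.sum_congr rfl fun _ _ => Nat.card_pi

theorem card_iso_congr : ∀ p p' q : PlaneTree, Nonempty (Iso p p') →
    Nat.card (Iso p q) = Nat.card (Iso p' q)
  | node n c, node n' c', node m d, ⟨⟨e, f⟩⟩ => by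
    rw [card_iso_node, card_iso_node]
    refine Fintype.sum_equiv (e.equivCongr (Equiv.refl (Fin m))) _ _ fun g => ?_
    refine Fintype.prod_equiv e _ _ fun i => ?_
    rw [card_iso_congr (c i) (c' (e i)) _ ⟨f i⟩]
    simp

/-- The finite set of plane trees with fewer than `N` vertices. -/
noncomputable def ofOrderLT (N : ℕ) : Finset PlaneTree := (finite_order_lt N).toFinset

theorem mem_ofOrderLT {N : ℕ} {p : PlaneTree} : p ∈ ofOrderLT N ↔ p.order < N := by
  simp [ofOrderLT]

theorem order_pos : ∀ p : PlaneTree, 0 < p.order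
  | node n c => by rw [order_node]; omega

theorem order_lt_order_node {n : ℕ} (c : Fin n → PlaneTree) (i : Fin n) :
    (c i).order < (node n c).order := by
  rw [order_node]
  exact Nat.lt_succ_of_le (Finset.single_le_sum (f := fun i => order (c i))
    (fun _ _ => Nat.zero_le _) (Finset.mem_univ i))

theorem node_injective (n : ℕ) : Function.Injective (node n) := fun c d h => by
  cases h; rfl

/-- For each of the m! bijections between the branches, induction on the branches leaves a sum equal
to 1/m!. Only trees isomorphic to `q` contribute, so `P` may be any finite set that contains them.
-/
theorem sum_weight_mul_card_iso : ∀ (q : PlaneTree) (P : Finset PlaneTree),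
    (∀ p, Nonempty (Iso p q) → p ∈ P) →
      ∑ p ∈ P, p.weight * (Nat.card (Iso p q) : ℚ) = 1
  | node m d, P, hP => by
    classical
    have h0 : ∀ p, ¬ Nonempty (Iso p (node m d)) →
        p.weight * (Nat.card (Iso p (node m d)) : ℚ) = 0 := by
      intro p hp
      have := not_nonempty_iff.1 hp
      simp
    let J := ofOrderLT (node m d).order
    -- The index set is exchanged for one of product form, so that the sum over the tuples of
    -- branches factors.
    have hJ : ∑ p ∈ P, p.weight * (Nat.card (Iso p (node m d)) : ℚ) =
        ∑ p ∈ (Fintype.piFinset fun _ : Fin m => J).map ⟨node m, node_injective m⟩,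
          p.weight * (Nat.card (Iso p (node m d)) : ℚ) := by
      refine Finset.sum_congr_of_eq_on_inter (fun p _ hp => h0 p fun hi => hp ?_)
        (fun p _ hp => h0 p fun hi => hp (hP p hi)) fun _ _ _ => rfl
      have ho := order_eq_of_iso _ _ hi
      rcases p with ⟨n, c⟩
      obtain ⟨⟨e, f⟩⟩ := hi
      obtain rfl : n = m := by simpa using Fintype.card_congr e
      refine Finset.mem_map.2 ⟨c, Fintype.mem_piFinset.2 fun i => mem_ofOrderLT.2 ?_, rfl⟩
      rw [← ho]
      exact order_lt_order_node c i
    rw [hJ, Finset.sum_map]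
    simp only [Function.Embedding.coeFn_mk, card_iso_node, weight]
    push_cast
    simp only [Finset.mul_sum, mul_assoc, ← Finset.prod_mul_distrib]
    rw [Finset.sum_comm]
    have : ∀ e : Fin m ≃ Fin m, ∑ c ∈ Fintype.piFinset fun _ : Fin m => J,
        (m.factorial : ℚ)⁻¹ * ∏ i, weight (c i) * (Nat.card (Iso (c i) (d (e i))) : ℚ) =
          (m.factorial : ℚ)⁻¹ := by
      intro e
      rw [← Finset.mul_sum, ← Finset.prod_univ_sum (fun _ : Fin m => J)
        (fun i p => weight p * (Nat.card (Iso p (d (e i))) : ℚ)), Finset.prod_eq_one, mul_one]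
      refine fun i _ => sum_weight_mul_card_iso (d (e i)) J fun p hp => mem_ofOrderLT.2 ?_
      rw [order_eq_of_iso _ _ hp]
      exact order_lt_order_node d (e i)
    rw [Finset.sum_congr rfl fun e _ => this e, Finset.sum_const, Finset.card_univ,
      Fintype.card_perm, Fintype.card_fin, nsmul_eq_mul, mul_inv_cancel₀]
    exact Nat.cast_ne_zero.2 m.factorial_ne_zero

end PlaneTree

namespace RTree

theorem order_mk (p : PlaneTree) : (mk p).order = p.order :=
  PlaneTree.order_eq_of_iso _ _ (mk_eq_mk.1 (mk_rep _))

theorem sum_weight_of_mk_eq [DecidableEq RTree] (t : RTree) (N : ℕ) (hN : t.order < N) :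
    ∑ p ∈ PlaneTree.ofOrderLT N with mk p = t, p.weight = (t.symmetryFactor : ℚ)⁻¹ := by
  have h := PlaneTree.sum_weight_mul_card_iso t.rep {p ∈ PlaneTree.ofOrderLT N | mk p = t} (by
    intro p hp
    refine Finset.mem_filter.2 ⟨PlaneTree.mem_ofOrderLT.2 ?_, (mk_eq_mk.2 hp).trans (mk_rep t)⟩
    rwa [PlaneTree.order_eq_of_iso _ _ hp])
  rw [Finset.sum_congr rfl (g := fun p : PlaneTree => p.weight * (t.symmetryFactor : ℚ)),
    ← Finset.sum_mul] at h
  · exact eq_inv_of_mul_eq_one_left h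
  · intro p hp
    rw [symmetryFactor, PlaneTree.card_iso_congr p t.rep t.rep
      (mk_eq_mk.1 ((Finset.mem_filter.1 hp).2.trans (mk_rep t).symm))]

/-- Grouping plane trees by isomorphism class trades the recursive weights for the symmetry factors.
-/
theorem sum_weight_smul {K M : Type*} [CommRing K] [Algebra ℚ K] [AddCommGroup M] [Module K M]
    (N : ℕ) (f : RTree → M) :
    ∑ p ∈ PlaneTree.ofOrderLT N, algebraMap ℚ K p.weight • f (mk p) =
      ∑ m ∈ Finset.range N, ∑ t ∈ ofOrder m, algebraMap ℚ K (t.symmetryFactor : ℚ)⁻¹ • f t := by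
  classical
  rw [← Finset.sum_fiberwise_of_maps_to (s := PlaneTree.ofOrderLT N) (t := Finset.range N)
    (g := PlaneTree.order) fun p hp => Finset.mem_range.2 (PlaneTree.mem_ofOrderLT.1 hp)]
  refine Finset.sum_congr rfl fun m hm => ?_
  rw [← Finset.sum_fiberwise_of_maps_to (t := ofOrder m) (g := mk) fun p hp => by
    rw [mem_ofOrder, order_mk, (Finset.mem_filter.1 hp).2]]
  refine Finset.sum_congr rfl fun t ht => ?_
  rw [mem_ofOrder] at ht
  rw [← sum_weight_of_mk_eq t N (ht ▸ Finset.mem_range.1 hm), map_sum, Finset.sum_smul,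
    Finset.filter_filter]
  refine Finset.sum_congr (Finset.filter_congr fun p _ => ?_) fun p hp => ?_
  · refine ⟨fun h => h.2, fun h => ⟨?_, h⟩⟩
    rw [← ht, ← h, order_mk]
  · rw [(Finset.mem_filter.1 hp).2]

end RTree

/-! ### Series over plane trees and their fixed point equations -/

section PlaneSeries

variable {K : Type*} [CommRing K] [Algebra ℚ K]

variable {A R : Type*} [LeftPreLieRing A] [LeftPreLieAlgebra K A] [CommRing R] [Algebra K R]

/-- The weighted sum of `ω(p) ⊗ F_x(p)` over the plane trees `p` with fewer than `N` vertices. -/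
noncomputable def planeSeries (N : ℕ) (ω : PlaneTree → R) (x : A) : R ⊗[K] A :=
  ∑ p ∈ PlaneTree.ofOrderLT N, algebraMap ℚ K p.weight • (ω p ⊗ₜ[K] planeDiff x p)

theorem rTensor_planeSeries {R' : Type*} [CommRing R'] [Algebra K R'] (φ : R →ₗ[K] R') (N : ℕ)
    (ω : PlaneTree → R) (x : A) :
    φ.rTensor A (planeSeries N ω x) = planeSeries N (fun p => φ (ω p)) x := by
  simp only [planeSeries, map_sum, map_smul, LinearMap.rTensor_tmul]

/-- Splitting off the root factors all the data: the weight gives 1/n! and the weights of the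
branches, F becomes a brace, and `hω` says the same of the coefficients. Multilinearity of the brace
then collects the sums over the branches into an exponential. -/
theorem planeSeries_eq {h : K} {N : ℕ} (hN : h ^ N = 0) (ω : PlaneTree → R) (B Λ : R →ₗ[K] R)
    (hω : ∀ n c, ω (.node n c) = B (∏ i, Λ (ω (c i)))) (x : A) :
    planeSeries N ω (h • x) = B.rTensor A (braceExp K N
      (Λ.rTensor A (planeSeries N ω (h • x))) (tensorIncl K R (h • x))) := by
  classical
  let f : PlaneTree → R ⊗[K] A := fun p =>
    algebraMap ℚ K p.weight • (ω p ⊗ₜ[K] planeDiff (h • x) p)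
  let S : Finset (Σ n : ℕ, Fin n → PlaneTree) := (Finset.range N).sigma fun n =>
    Fintype.piFinset fun _ => PlaneTree.ofOrderLT N
  have hinj : Function.Injective fun s : Σ n : ℕ, Fin n → PlaneTree => PlaneTree.node s.1 s.2 := by
    rintro ⟨n, c⟩ ⟨m, d⟩ hcd
    cases hcd
    rfl
  -- `S` indexes all trees with fewer than `N` vertices, and some larger ones whose terms vanish
  -- because they contain `h ^ N`.
  have hS : planeSeries N ω (h • x) = ∑ p ∈ S.map ⟨_, hinj⟩, f p := by
    refine Finset.sum_subset (fun p hp => ?_) fun p _ hp => ?_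
    · rw [PlaneTree.mem_ofOrderLT] at hp
      rcases p with ⟨n, c⟩
      refine Finset.mem_map.2 ⟨⟨n, c⟩, Finset.mem_sigma.2 ⟨Finset.mem_range.2 ?_,
        Fintype.mem_piFinset.2 fun i => PlaneTree.mem_ofOrderLT.2
          ((PlaneTree.order_lt_order_node c i).trans hp)⟩, rfl⟩
      refine lt_of_le_of_lt ?_ hp
      rw [PlaneTree.order_node]
      calc n = ∑ i : Fin n, 1 := by simp
        _ ≤ ∑ i, (c i).order := Finset.sum_le_sum fun i _ => PlaneTree.order_pos (c i)
        _ ≤ _ := Nat.le_succ _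
    · rw [PlaneTree.mem_ofOrderLT, not_lt] at hp
      rw [planeDiff_smul, pow_eq_zero_of_le hp hN, zero_smul, TensorProduct.tmul_zero, smul_zero]
  refine hS.trans ?_
  rw [Finset.sum_map, Finset.sum_sigma, rTensor_planeSeries, braceExp, map_sum]
  refine Finset.sum_congr rfl fun n _ => ?_
  rw [planeSeries, brace_sum_finset (K := K), Finset.smul_sum, map_sum]
  refine Finset.sum_congr rfl fun c _ => ?_
  rw [brace_smul_univ, tensorIncl_apply, brace_tmul, map_smul, map_smul, smul_smul,
    LinearMap.rTensor_tmul, one_mul, ← hω, ← map_prod, invFactorial, ← map_mul]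
  rfl

end PlaneSeries

/-! ### Uniqueness of fixed points by h-adic contraction -/

section Contraction

variable {K : Type*} [CommRing K] {L : Type*} [LeftPreLieRing L] [LeftPreLieAlgebra K L]

theorem brace_sub_mem (I : Submodule K L) (hl : ∀ x, ∀ y ∈ I, x * y ∈ I)
    (hr : ∀ x ∈ I, ∀ y, x * y ∈ I) (a : L) : ∀ (n : ℕ) (v w : Fin n → L),
      (∀ i, v i - w i ∈ I) → brace a n v - brace a n w ∈ I := by
  have hmul : ∀ x x' y y' : L, x - x' ∈ I → y - y' ∈ I → x * y - x' * y' ∈ I := by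
    intro x x' y y' hx hy
    have : x * y - x' * y' = (x - x') * y + x' * (y - y') := by
      rw [sub_mul, mul_sub]; abel
    rw [this]
    exact I.add_mem (hr _ hx _) (hl _ _ hy)
  intro n
  induction n with
  | zero => intro v w _; simp [brace]
  | succ n ih =>
    intro v w hvw
    simp only [brace]
    rw [sub_sub_sub_comm, ← Finset.sum_sub_distrib]
    refine I.sub_mem (hmul _ _ _ _ (hvw 0) (ih _ _ fun i => hvw i.succ))
      (I.sum_mem fun i _ => ih _ _ fun j => ?_)
    by_cases hj : j = i
    · subst hj
      simpa [Fin.tail] using hmul _ _ _ _ (hvw 0) (hvw j.succ)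
    · simpa [hj, Fin.tail] using hvw j.succ

/-- Solutions that agree modulo `h ^ n` agree modulo `h ^ (n + 1)`, because the base `h • x` of the
braces supplies one more factor `h`; and `h ^ N` is zero. -/
theorem braceExp_fixedPoint_unique [Algebra ℚ K] {h : K} {N : ℕ} (hN : h ^ N = 0)
    (B Λ : L →ₗ[K] L) (x V W : L) (hV : V = B (braceExp K N (Λ V) (h • x)))
    (hW : W = B (braceExp K N (Λ W) (h • x))) : V = W := by
  have key : ∀ n, V - W ∈ LinearMap.range (LinearMap.lsmul K L (h ^ n)) := by
    intro n
    induction n with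
    | zero => exact ⟨V - W, by simp⟩
    | succ n ih =>
      -- The base is `x` here; the factor `h` is pulled out of `h • x` afterwards. The multiples of
      -- `h ^ n` form a two-sided ideal, so braces respect congruence modulo it.
      have hE : braceExp K N (Λ V) x - braceExp K N (Λ W) x ∈
          LinearMap.range (LinearMap.lsmul K L (h ^ n)) := by
        rw [braceExp, braceExp, ← Finset.sum_sub_distrib]
        refine Submodule.sum_mem _ fun m _ => ?_
        rw [← smul_sub]
        refine Submodule.smul_mem _ _ (brace_sub_mem _ ?_ ?_ _ _ _ _ fun _ => ?_)
        · rintro y _ ⟨d, rfl⟩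
          exact ⟨y * d, by simp [mul_smul_comm]⟩
        · rintro _ ⟨d, rfl⟩ y
          exact ⟨d * y, by simp [smul_mul_assoc]⟩
        · obtain ⟨d, hd⟩ := ih
          rw [← map_sub, ← hd]
          exact ⟨Λ d, by simp⟩
      obtain ⟨d, hd⟩ := hE
      refine ⟨B d, ?_⟩
      rw [hV, hW, ← map_sub, braceExp_smul_right, braceExp_smul_right, ← smul_sub, ← hd,
        LinearMap.lsmul_apply, LinearMap.lsmul_apply, smul_smul, map_smul, pow_succ']
  obtain ⟨d, hd⟩ := key N
  rw [hN] at hd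
  exact sub_eq_zero.1 (by simpa using hd.symm)

end Contraction

/-! ### Coefficient maps that treat the trees of one kind as scalars -/

section Semilinear

variable {K S R R' A : Type*} [CommRing K] [CommRing S] [Algebra K S] [CommRing R] [Algebra K R]
  [Algebra S R] [IsScalarTower K S R] [CommRing R'] [Algebra K R'] [Algebra S R']
  [IsScalarTower K S R'] [LeftPreLieRing A] [LeftPreLieAlgebra K A]

theorem rTensor_tensorMap_mul (φ : R →ₗ[S] R') (z : S ⊗[K] A) (y : R ⊗[K] A) :
    (φ.restrictScalars K).rTensor A (tensorMap A (IsScalarTower.toAlgHom K S R) z * y) =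
      tensorMap A (IsScalarTower.toAlgHom K S R') z * (φ.restrictScalars K).rTensor A y := by
  induction z using TensorProduct.induction_on with
  | zero => simp
  | add x x' hx hx' => simp only [add_mul, map_add, hx, hx']
  | tmul s a =>
  induction y using TensorProduct.induction_on with
  | zero => simp
  | add x x' hx hx' => simp only [mul_add, map_add, hx, hx']
  | tmul r b =>
    simp [tensorMap_tmul, Algebra.TensorProduct.tmul_mul_tmul, ← Algebra.smul_def]

/-- Coefficients from `S` act as scalars for the `S`-linear map `φ`, so entries defined over `S`
pass through it. It is used with `S` the forests of the second kind and `φ` acting on the first kind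
only. -/
theorem rTensor_brace (φ : R →ₗ[S] R') (b : R ⊗[K] A) : ∀ (n : ℕ) (v : Fin n → S ⊗[K] A),
    (φ.restrictScalars K).rTensor A
        (brace b n (tensorMap A (IsScalarTower.toAlgHom K S R) ∘ v)) =
      brace ((φ.restrictScalars K).rTensor A b) n
        (tensorMap A (IsScalarTower.toAlgHom K S R') ∘ v) := by
  intro n
  induction n with
  | zero => intro v; rfl
  | succ n ih =>
    intro v
    have h := fun i : Fin n => ih (Function.update (Fin.tail v) i (v 0 * Fin.tail v i))
    simp only [Function.comp_update, map_mul] at h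
    simp only [brace, map_sub, map_sum]
    refine congrArg₂ _ ?_ (Finset.sum_congr rfl fun i _ => h i)
    rw [Function.comp_apply, rTensor_tensorMap_mul]
    exact congrArg _ (ih (Fin.tail v))

theorem rTensor_braceExp [Algebra ℚ K] (φ : R →ₗ[S] R') (N : ℕ) (b : R ⊗[K] A) (z : S ⊗[K] A) :
    (φ.restrictScalars K).rTensor A
        (braceExp K N (tensorMap A (IsScalarTower.toAlgHom K S R) z) b) =
      braceExp K N (tensorMap A (IsScalarTower.toAlgHom K S R') z)
        ((φ.restrictScalars K).rTensor A b) := by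
  simp only [braceExp, map_sum, map_smul]
  exact Finset.sum_congr rfl fun n _ => congrArg _ (rTensor_brace φ b n fun _ => z)

end Semilinear

/-! ### Joining the trees of a forest to a common root -/

theorem RTree.mk_ofList_congr {a b : List PlaneTree} (h : (a.map mk).Perm (b.map mk)) :
    mk (PlaneTree.ofList a) = mk (PlaneTree.ofList b) := by
  classical
  let e : Fin a.length ≃ Fin b.length := (finCongr (List.length_map mk).symm).trans
    ((Equiv.ofBijective h.idxBij ⟨h.idxBij_injective, h.idxBij_surjective⟩).trans
      (finCongr (List.length_map mk)))
  refine mk_node e fun i => ?_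
  have := h.getElem_idxBij_eq_getElem (finCongr (List.length_map mk).symm i)
  rw [List.getElem_map, List.getElem_map] at this
  exact this.symm

/-- The tree obtained by joining the roots of the trees of a forest to a new root. -/
noncomputable def RTree.join (s : Multiset RTree) : RTree :=
  mk (PlaneTree.ofList (s.toList.map rep))

theorem RTree.mk_ofList (l : List PlaneTree) :
    mk (PlaneTree.ofList l) = join ((l.map mk : List RTree) : Multiset RTree) := by
  refine mk_ofList_congr ?_
  rw [List.map_map, show mk ∘ rep = id from funext mk_rep, List.map_id]
  exact (Multiset.coe_eq_coe.1 (Multiset.coe_toList _)).symm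

theorem RTree.mk_ofList_children (p : PlaneTree) :
    mk (PlaneTree.ofList p.children) = mk p := by
  rcases p with ⟨n, c⟩
  refine mk_node (finCongr (List.length_ofFn)) fun i => ?_
  exact congrArg mk (List.get_ofFn c i)

theorem PlaneTree.children_ofList (l : List PlaneTree) : (ofList l).children = l :=
  List.ofFn_get l

theorem RTree.mk_node_eq_join (n : ℕ) (c : Fin n → PlaneTree) :
    mk (.node n c) = join (((List.finRange n).map fun i => mk (c i) : List RTree) :
      Multiset RTree) := by
  rw [← mk_ofList_children, mk_ofList, PlaneTree.children, List.ofFn_eq_map, List.map_map]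
  rfl

section ForestMaps

variable {K : Type*} [CommRing K]

theorem MvPolynomial.prod_map_X [DecidableEq RTree] (s : Multiset RTree) :
    (s.map (MvPolynomial.X (R := K))).prod =
      MvPolynomial.monomial (Multiset.toFinsupp s) 1 := by
  induction s using Multiset.induction_on with
  | empty => simp
  | cons t s ih =>
    rw [Multiset.map_cons, Multiset.prod_cons, ih, MvPolynomial.X, MvPolynomial.monomial_mul,
      ← Multiset.singleton_add, map_add, Multiset.toFinsupp_singleton, one_mul]

variable (K) in
/-- The linear map on the algebra of forests that joins the trees of a forest to a new root. -/
noncomputable def joinForest : MvPolynomial RTree K →ₗ[K] MvPolynomial RTree K :=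
  (MvPolynomial.basisMonomials RTree K).constr K fun m =>
    MvPolynomial.X (RTree.join (Finsupp.toMultiset m))

theorem joinForest_prod (s : Multiset RTree) :
    joinForest K (s.map MvPolynomial.X).prod = MvPolynomial.X (RTree.join s) := by
  classical
  rw [MvPolynomial.prod_map_X, show MvPolynomial.monomial (Multiset.toFinsupp s) (1 : K) =
    MvPolynomial.basisMonomials RTree K (Multiset.toFinsupp s) by simp, joinForest,
    Module.Basis.constr_basis, Multiset.toFinsupp_toMultiset]

theorem joinForest_C_mul_prod (r : K) (s : Multiset RTree) :
    joinForest K (MvPolynomial.C r * (s.map MvPolynomial.X).prod) =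
      MvPolynomial.C r * MvPolynomial.X (RTree.join s) := by
  rw [← MvPolynomial.smul_eq_C_mul, map_smul, joinForest_prod, MvPolynomial.smul_eq_C_mul]

/-- A linear form on the algebra of forests with prescribed values on trees. -/
noncomputable def treeForm (f : RTree → K) : MvPolynomial RTree K →ₗ[K] K :=
  -- Only the values on single trees matter; those on other forests are a convenient default.
  (MvPolynomial.basisMonomials RTree K).constr K fun m => ∑ t ∈ m.support, f t

theorem treeForm_X (f : RTree → K) (t : RTree) : treeForm f (MvPolynomial.X t) = f t := by
  rw [MvPolynomial.X, show MvPolynomial.monomial (Finsupp.single t 1) (1 : K) =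
    MvPolynomial.basisMonomials RTree K (Finsupp.single t 1) by simp, treeForm,
    Module.Basis.constr_basis,
    Finsupp.support_single _ one_ne_zero, Finset.sum_singleton]

theorem treeForm_C_mul_X (f : RTree → K) (r : K) (t : RTree) :
    treeForm f (MvPolynomial.C r * MvPolynomial.X t) = r * f t := by
  rw [← MvPolynomial.smul_eq_C_mul, map_smul, treeForm_X, smul_eq_mul]

end ForestMaps

/-! ### The sum over the spanning subforests -/

section SubforestSum

variable {K : Type*} [CommRing K] (α : RTree → K)

/-- Forests with two kinds of trees. -/
abbrev BiForest (K : Type*) [CommRing K] : Type _ := MvPolynomial RTree (MvPolynomial RTree K)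

/-- Evaluation of the trees of the first kind by `α`. -/
noncomputable def firstForm : BiForest K →ₗ[MvPolynomial RTree K] MvPolynomial RTree K :=
  treeForm fun t => MvPolynomial.C (α t)

/-- Evaluation of the trees of the first kind by `α`, followed by the joining of the trees of the
second kind. -/
noncomputable def evalJoin : BiForest K →ₗ[K] MvPolynomial RTree K :=
  joinForest K ∘ₗ (firstForm α).restrictScalars K

/-- The constant polynomials, as a linear map. -/
noncomputable def secondIncl : MvPolynomial RTree K →ₗ[K] BiForest K :=
  (Algebra.linearMap (MvPolynomial RTree K) (BiForest K)).restrictScalars K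

theorem secondIncl_apply (x : MvPolynomial RTree K) : secondIncl x = MvPolynomial.C x := rfl

/-- The term of a spanning subforest: the component of the root is recorded as a tree of the first
kind, the other components are evaluated by `α`, and the branches of the contracted tree are
recorded as trees of the second kind. -/
noncomputable def subforestTerm (p : PlaneTree) (s : p.SpanningSubforest) : BiForest K :=
  MvPolynomial.C (MvPolynomial.C (((p.otherComponents s).map fun q => α (RTree.mk q)).prod) *
    (((p.contract s).children.map fun q => MvPolynomial.X (RTree.mk q))).prod) *
      MvPolynomial.X (RTree.mk (p.rootComponent s))

/-- The sum of the terms of all the spanning subforests. -/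
noncomputable def subforestSum (p : PlaneTree) : BiForest K :=
  ∑ s : p.SpanningSubforest, subforestTerm α p s

/-- Evaluating the root component completes the product of α over all the components, and joining
the branches of the contracted tree restores that tree. This is the summand of the convolution
before β is applied. -/
theorem evalJoin_subforestTerm (p : PlaneTree) (s : p.SpanningSubforest) :
    evalJoin α (subforestTerm α p s) =
      MvPolynomial.C (((p.components s).map fun q => α (RTree.mk q)).prod) *
        MvPolynomial.X (RTree.mk (p.contract s)) := by
  change joinForest K (treeForm _ _) = _
  rw [subforestTerm, treeForm_C_mul_X, mul_right_comm, ← map_mul]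
  have := joinForest_C_mul_prod (((p.otherComponents s).map fun q => α (RTree.mk q)).prod *
    α (RTree.mk (p.rootComponent s)))
    (((p.contract s).children.map RTree.mk : List RTree) : Multiset RTree)
  rw [← RTree.mk_ofList, RTree.mk_ofList_children, Multiset.map_coe, Multiset.prod_coe,
    List.map_map] at this
  rw [PlaneTree.components, Multiset.map_cons, Multiset.prod_cons,
    mul_comm (α (RTree.mk (p.rootComponent s)))]
  exact this

/-- The contribution of a branch to the term of a spanning subforest. The Boolean says whether the
edge to the branch belongs to the subforest. -/
noncomputable def branchTerm (p : PlaneTree) (s : Bool × p.SpanningSubforest) : BiForest K :=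
  MvPolynomial.C (MvPolynomial.C (((p.otherComponents s.2 +
      if s.1 then 0 else {p.rootComponent s.2}).map fun q => α (RTree.mk q)).prod) *
    ((if s.1 then (p.contract s.2).children else [p.contract s.2]).map
      fun q => MvPolynomial.X (RTree.mk q)).prod) *
      if s.1 then MvPolynomial.X (RTree.mk (p.rootComponent s.2)) else 1

/-- A kept edge gives the term of the branch unchanged, hence the identity. A cut edge closes the
root component of the branch and makes the contracted branch a child in the contracted tree, hence
evaluation followed by joining. -/
theorem sum_branchTerm (p : PlaneTree) :
    ∑ s : Bool × p.SpanningSubforest, branchTerm α p s =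
      (LinearMap.id + secondIncl ∘ₗ evalJoin α : BiForest K →ₗ[K] BiForest K)
        (subforestSum α p) := by
  have h1 : ∀ s, branchTerm α p (true, s) = subforestTerm α p s := fun s => by
    simp only [branchTerm, subforestTerm, if_true, add_zero]
  have h2 : ∀ s, branchTerm α p (false, s) = secondIncl (evalJoin α (subforestTerm α p s)) :=
    fun s => by
      rw [evalJoin_subforestTerm, secondIncl_apply, branchTerm, PlaneTree.components,
        ← Multiset.singleton_add, add_comm {p.rootComponent s}]
      simp only [Bool.false_eq_true, if_false, mul_one, List.map_cons, List.map_nil, List.prod_cons,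
        List.prod_nil]
  rw [Fintype.sum_prod_type, Fintype.sum_bool, LinearMap.add_apply, LinearMap.id_apply,
    LinearMap.comp_apply, subforestSum, map_sum, map_sum]
  exact congrArg₂ (· + ·) (Finset.sum_congr rfl fun s _ => h1 s)
    (Finset.sum_congr rfl fun s _ => h2 s)

theorem Multiset.prod_map_finset_sum {ι β M : Type*} [CommMonoid M] (s : Finset ι)
    (g : ι → Multiset β) (f : β → M) : ((∑ i ∈ s, g i).map f).prod = ∏ i ∈ s, ((g i).map f).prod := by
  classical
  induction s using Finset.induction_on with
  | empty => simp
  | insert i s hi ih => simp [hi, ih]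

theorem List.prod_map_flatMap {ι β M : Type*} [CommMonoid M] (l : List ι) (g : ι → List β)
    (f : β → M) : ((l.flatMap g).map f).prod = (l.map fun i => ((g i).map f).prod).prod := by
  induction l with
  | nil => simp
  | cons i l ih => simp [ih]

theorem List.prod_map_filter_map {ι β M : Type*} [CommMonoid M] (l : List ι) (b : ι → Bool)
    (g : ι → β) (f : β → M) : (((l.filter b).map g).map f).prod =
      (l.map fun i => if b i then f (g i) else 1).prod := by
  induction l with
  | nil => simp
  | cons i l ih => by_cases h : b i <;> simp [h, ← ih]

/-- The root component is the join of those of the branches with kept edges, which are the trees of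
the first kind in the product; all other data are multiplicative over the branches. -/
theorem joinForest_prod_branchTerm (n : ℕ) (c : Fin n → PlaneTree)
    (s : ∀ i, Bool × (c i).SpanningSubforest) :
    joinForest (MvPolynomial RTree K) (∏ i, branchTerm α (c i) (s i)) =
      subforestTerm α (.node n c) s := by
  have hc : MvPolynomial.C (MvPolynomial.C (((PlaneTree.otherComponents (.node n c) s).map
      fun q => α (RTree.mk q)).prod) * (((PlaneTree.contract (.node n c) s).children.map
        fun q => MvPolynomial.X (RTree.mk q))).prod) =
      ∏ i, (MvPolynomial.C (MvPolynomial.C ((((c i).otherComponents (s i).2 +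
        if (s i).1 then 0 else {(c i).rootComponent (s i).2}).map fun q => α (RTree.mk q)).prod) *
      ((if (s i).1 then ((c i).contract (s i).2).children else [(c i).contract (s i).2]).map
        fun q => MvPolynomial.X (RTree.mk q)).prod) : BiForest K) := by
    rw [← map_prod, Finset.prod_mul_distrib, ← map_prod, ← Multiset.prod_map_finset_sum]
    congr 2
    have h : PlaneTree.contract (.node n c) s = PlaneTree.ofList ((List.finRange n).flatMap fun i =>
        if (s i).1 then ((c i).contract (s i).2).children else [(c i).contract (s i).2]) := rfl
    rw [h, PlaneTree.children_ofList, List.prod_map_flatMap, Fin.prod_univ_def]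
  have hx : (∏ i, if (s i).1 then MvPolynomial.X (RTree.mk ((c i).rootComponent (s i).2)) else 1 :
      BiForest K) = (((((List.finRange n).filter fun i => (s i).1).map
        fun i => (c i).rootComponent (s i).2).map RTree.mk : Multiset RTree).map
          MvPolynomial.X).prod := by
    rw [Multiset.map_coe, Multiset.prod_coe, List.map_map, List.prod_map_filter_map,
      Fin.prod_univ_def]
    rfl
  simp only [branchTerm]
  rw [Finset.prod_mul_distrib, hx, ← hc, joinForest_C_mul_prod, ← RTree.mk_ofList]
  rfl

theorem subforestSum_node (n : ℕ) (c : Fin n → PlaneTree) :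
    subforestSum α (.node n c) = (joinForest (MvPolynomial RTree K)).restrictScalars K
      (∏ i, (LinearMap.id + secondIncl ∘ₗ evalJoin α : BiForest K →ₗ[K] BiForest K)
        (subforestSum α (c i))) := by
  simp only [← sum_branchTerm]
  rw [Finset.prod_univ_sum, map_sum, Fintype.piFinset_univ]
  exact Finset.sum_congr rfl fun s _ => (joinForest_prod_branchTerm α n c s).symm

/-- The recursion at the root is symmetric in the branches, so no explicit bijection between
spanning subforests is needed. -/
theorem subforestSum_iso : ∀ p q : PlaneTree, Nonempty (PlaneTree.Iso p q) →
    subforestSum α p = subforestSum α q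
  | .node n c, .node m d, ⟨⟨e, f⟩⟩ => by
    rw [subforestSum_node, subforestSum_node]
    congr 1
    refine Fintype.prod_equiv e _ _ fun i => ?_
    rw [subforestSum_iso (c i) (d (e i)) ⟨f i⟩]

end SubforestSum

/-! ### Substitution of series over plane trees -/

section Substitution

variable {K : Type*} [CommRing K] [Algebra ℚ K] {A : Type*} [LeftPreLieRing A]
  [LeftPreLieAlgebra K A]

/-- Every tree has a vertex, so every term is divisible by `h`. This puts the series in the form
that the group law requires of its exponents. -/
theorem exists_planeSeries_eq_smul {R : Type*} [CommRing R] [Algebra K R] (h : K) (N : ℕ)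
    (ω : PlaneTree → R) (x : A) : ∃ y : R ⊗[K] A, planeSeries N ω (h • x) = h • y := by
  refine ⟨∑ p ∈ PlaneTree.ofOrderLT N,
    algebraMap ℚ K p.weight • h ^ (p.order - 1) • (ω p ⊗ₜ[K] planeDiff x p), ?_⟩
  rw [planeSeries, Finset.smul_sum]
  refine Finset.sum_congr rfl fun p _ => ?_
  have hp : h ^ p.order = h ^ (p.order - 1) * h := by
    rw [← pow_succ, Nat.sub_add_cancel p.order_pos]
  rw [planeDiff_smul, hp, TensorProduct.tmul_smul, smul_comm h, mul_comm, mul_smul]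

theorem planeSeries_X_eq {h : K} {N : ℕ} (hN : h ^ N = 0) (S : Type*) [CommRing S] [Algebra K S]
    (x : A) :
    planeSeries N (fun p => (MvPolynomial.X (RTree.mk p) : MvPolynomial RTree S)) (h • x) =
      ((joinForest S).restrictScalars K).rTensor A (braceExp K N
        (planeSeries N (fun p => (MvPolynomial.X (RTree.mk p) : MvPolynomial RTree S)) (h • x))
        (tensorIncl K _ (h • x))) := by
  have := planeSeries_eq hN (fun p => (MvPolynomial.X (RTree.mk p) : MvPolynomial RTree S))
    ((joinForest S).restrictScalars K) LinearMap.id (fun n c => ?_) x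
  · rwa [LinearMap.rTensor_id, LinearMap.id_apply] at this
  · have h := joinForest_prod (K := S)
      (((List.finRange n).map fun i => RTree.mk (c i) : List RTree) : Multiset RTree)
    rw [← RTree.mk_node_eq_join, Multiset.map_coe, Multiset.prod_coe, List.map_map] at h
    simp only [LinearMap.id_apply, LinearMap.coe_restrictScalars]
    rw [← h, Fin.prod_univ_def]
    rfl

/-- The composition law over a nilpotent base: the series `V` = E_Z(U) is identified with the series
`W` of spanning subforests, since both solve one fixed point equation. -/
theorem sum_planeDiff_substitution {h : K} {N : ℕ} (hN0 : 0 < N) (hN : h ^ N = 0)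
    (α β : RTree → K) (a x : A)
    (hx : h • x = ∑ p ∈ PlaneTree.ofOrderLT N,
      algebraMap ℚ K p.weight • α (RTree.mk p) • planeDiff (h • a) p) :
    ∑ p ∈ PlaneTree.ofOrderLT N,
        algebraMap ℚ K p.weight • β (RTree.mk p) • planeDiff (h • x) p =
      ∑ p ∈ PlaneTree.ofOrderLT N, algebraMap ℚ K p.weight •
        treeForm β (evalJoin α (subforestSum α p)) • planeDiff (h • a) p := by
  let Z : MvPolynomial RTree K ⊗[K] A :=
    planeSeries N (fun p => MvPolynomial.X (RTree.mk p)) (h • x)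
  let U : BiForest K ⊗[K] A := planeSeries N (fun p => MvPolynomial.X (RTree.mk p)) (h • a)
  let W : BiForest K ⊗[K] A := planeSeries N (subforestSum α) (h • a)
  let ι := tensorMap A (IsScalarTower.toAlgHom K (MvPolynomial RTree K) (BiForest K))
  let V : BiForest K ⊗[K] A := braceExp K N (ι Z) U
  let B : BiForest K →ₗ[K] BiForest K := (joinForest (MvPolynomial RTree K)).restrictScalars K
  let Λ : BiForest K →ₗ[K] BiForest K := LinearMap.id + secondIncl ∘ₗ evalJoin α
  obtain ⟨z, hz⟩ : ∃ z, Z = h • z := exists_planeSeries_eq_smul h N _ x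
  obtain ⟨u, hu⟩ : ∃ u, U = h • u := exists_planeSeries_eq_smul h N _ a
  have hιz : ι Z = h • ι z := by rw [hz]; exact tensorMap_smul _ _ _
  have hZ : Z = (joinForest K).rTensor A (braceExp K N Z (tensorIncl K _ (h • x))) :=
    planeSeries_X_eq hN K x
  have hU : U = B.rTensor A (braceExp K N U (tensorIncl K _ (h • a))) :=
    planeSeries_X_eq hN (MvPolynomial RTree K) a
  have hW : W = B.rTensor A (braceExp K N (Λ.rTensor A W) (tensorIncl K _ (h • a))) :=
    planeSeries_eq hN (subforestSum α) B Λ (subforestSum_node α) a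
  -- The operator E_Z has coefficients of the second kind, so it commutes with joining the first
  -- kind. Applied to the equation for `U`, it produces a composite of two exponentials, which the
  -- group law merges.
  have hV : V = B.rTensor A (braceExp K N (ι Z + V) (tensorIncl K _ (h • a))) := by
    have h1 : V = B.rTensor A (braceExp K N (ι Z) (braceExp K N U (tensorIncl K _ (h • a)))) := by
      refine (congrArg (braceExp K N (ι Z)) hU).trans ?_
      exact (rTensor_braceExp (joinForest (MvPolynomial RTree K)) N _ Z).symm
    refine h1.trans ?_
    rw [hιz, hu, braceExp_braceExp hN0 hN, ← hu, ← hιz]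
  have hfirst : ((firstForm α).restrictScalars K).rTensor A V =
      braceExp K N Z (tensorIncl K _ (h • x)) := by
    refine (rTensor_braceExp (firstForm α) N U Z).trans ?_
    have h1 : tensorMap A (IsScalarTower.toAlgHom K (MvPolynomial RTree K)
        (MvPolynomial RTree K)) Z = Z :=
      LinearMap.congr_fun (LinearMap.rTensor_id A (MvPolynomial RTree K)) Z
    -- Evaluating the universal series of `h • a` by α gives the α-series, which is `h • x` by
    -- assumption.
    have h2 : ((firstForm α).restrictScalars K).rTensor A U = tensorIncl K _ (h • x) := by
      rw [hx, map_sum, rTensor_planeSeries]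
      refine Finset.sum_congr rfl fun p _ => ?_
      have h3 : (firstForm α).restrictScalars K (MvPolynomial.X (RTree.mk p)) =
          α (RTree.mk p) • 1 := (treeForm_X _ _).trans MvPolynomial.C_eq_smul_one
      simp only [tensorIncl_apply, h3, TensorProduct.tmul_smul, TensorProduct.smul_tmul']
    rw [h1, h2]
  have hVZ : (evalJoin α).rTensor A V = Z := by
    rw [evalJoin, LinearMap.rTensor_comp, LinearMap.comp_apply, hfirst]
    exact hZ.symm
  -- This makes the equation for `V` self-contained: the outer series `Z` is itself recovered from
  -- `V`.
  have hΛ : Λ.rTensor A V = ι Z + V := by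
    rw [LinearMap.rTensor_add, LinearMap.rTensor_id, LinearMap.rTensor_comp, LinearMap.add_apply,
      LinearMap.comp_apply, hVZ, LinearMap.id_apply, add_comm]
    rfl
  have hVW : V = W := by
    refine braceExp_fixedPoint_unique hN (B.rTensor A) (Λ.rTensor A) (tensorIncl K _ a) V W ?_ ?_
    · rw [hΛ, ← tensorIncl_smul]; exact hV
    · rw [← tensorIncl_smul]; exact hW
  have hfinal := congrArg (fun y => TensorProduct.lid K A ((treeForm β).rTensor A y)) hVZ
  rw [hVW] at hfinal
  simp only [W, Z, rTensor_planeSeries, treeForm_X] at hfinal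
  simp only [planeSeries, map_sum, map_smul, TensorProduct.lid_tmul] at hfinal
  exact hfinal.symm

end Substitution

noncomputable instance TensorProduct.leftPreLieAlgebraLeft {K R A : Type*} [CommRing K] [CommRing R]
    [Algebra K R] [LeftPreLieRing A] [LeftPreLieAlgebra K A] :
    LeftPreLieAlgebra R (R ⊗[K] A) where

/-! ### Truncation of formal power series -/

section Truncation

open Polynomial

variable (k : Type*) [Field k] (N : ℕ)

/-- The algebra `k[h] / (h ^ N)`. -/
abbrev TruncPoly : Type _ := AdjoinRoot (X ^ N : k[X])

namespace TruncPoly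

/-- The class of `h`. -/
noncomputable def param : TruncPoly k N := AdjoinRoot.root _

theorem param_pow (j : ℕ) : param k N ^ j = AdjoinRoot.mk (X ^ N : k[X]) (X ^ j) := by
  rw [map_pow, AdjoinRoot.mk_X, param]

theorem param_pow_eq_zero : param k N ^ N = 0 := by
  rw [param_pow, AdjoinRoot.mk_self]

/-- The coefficient of `h ^ n`. -/
noncomputable def coeff (n : ℕ) : TruncPoly k N →ₗ[k] k :=
  Polynomial.lcoeff k n ∘ₗ AdjoinRoot.modByMonicHom (monic_X_pow N)

theorem coeff_param_pow (n : ℕ) (hn : n < N) (j : ℕ) :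
    coeff k N n (param k N ^ j) = if j = n then 1 else 0 := by
  by_cases hj : j < N
  · rw [param_pow, coeff, LinearMap.comp_apply, AdjoinRoot.modByMonicHom_mk,
      (modByMonic_eq_self_iff (monic_X_pow N)).2, lcoeff_apply, coeff_X_pow]
    · simp only [eq_comm]
    · rw [degree_X_pow, degree_X_pow]
      exact_mod_cast hj
  · rw [pow_eq_zero_of_le (not_lt.1 hj) (param_pow_eq_zero k N), map_zero, if_neg (by omega)]

variable {k} {A : Type*} [LeftPreLieRing A] [LeftPreLieAlgebra k A]

/-- The coefficient of `h ^ n` of an element of `k[h] / (h ^ N) ⊗ A`. -/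
noncomputable def tensorCoeff (n : ℕ) : TruncPoly k N ⊗[k] A →ₗ[k] A :=
  (TensorProduct.lid k A).toLinearMap ∘ₗ (coeff k N n).rTensor A

theorem tensorCoeff_param_pow_tmul (n : ℕ) (hn : n < N) (j : ℕ) (y : A) :
    tensorCoeff N n ((param k N ^ j) ⊗ₜ[k] y) = if j = n then y else 0 := by
  simp [tensorCoeff, coeff_param_pow k N n hn]

variable (k) in
/-- The truncation of formal power series, as a morphism. -/
noncomputable def ofSeries : HahnSeries ℕ A →ₙ+* TruncPoly k N ⊗[k] A where
  toFun y := ∑ i ∈ Finset.range N, (param k N ^ i) ⊗ₜ[k] y.coeff i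
  map_zero' := by simp
  map_add' x y := by simp [TensorProduct.tmul_add, Finset.sum_add_distrib]
  map_mul' x y := by
    rw [Finset.sum_mul_sum, ← Finset.sum_product']
    -- Pairs of exponents with sum at least `N` contribute zero, so only the pairs that occur in the
    -- truncated Cauchy product remain.
    have h := Finset.sum_filter_of_ne (s := Finset.range N ×ˢ Finset.range N)
      (p := fun p => p.1 + p.2 < N) (f := fun p => (param k N ^ p.1) ⊗ₜ[k] x.coeff p.1 *
        (param k N ^ p.2) ⊗ₜ[k] y.coeff p.2) (by
          intro p _ hp
          by_contra hlt
          refine hp ?_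
          rw [Algebra.TensorProduct.tmul_mul_tmul, ← pow_add,
            pow_eq_zero_of_le (not_lt.1 hlt) (param_pow_eq_zero k N), TensorProduct.zero_tmul])
    rw [← h, ← Finset.sum_fiberwise_of_maps_to (t := Finset.range N) 
      (g := fun p : ℕ × ℕ => p.1 + p.2)
      (by intro p hp; exact Finset.mem_range.2 (Finset.mem_filter.1 hp).2)]
    refine Finset.sum_congr rfl fun m hm => ?_
    rw [FormalSeries.coeff_mul, TensorProduct.tmul_sum]
    refine Finset.sum_congr ?_ fun p hp => ?_
    · ext p
      simp only [Finset.HasAntidiagonal.mem_antidiagonal, Finset.mem_filter, Finset.mem_product,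
        Finset.mem_range] at hm ⊢
      omega
    · rw [Algebra.TensorProduct.tmul_mul_tmul, ← pow_add, (Finset.mem_filter.1 hp).2]

theorem ofSeries_apply (y : HahnSeries ℕ A) :
    ofSeries k N y = ∑ i ∈ Finset.range N, (param k N ^ i) ⊗ₜ[k] y.coeff i := rfl

theorem tensorCoeff_param_pow_smul_ofSeries (n : ℕ) (hn : n < N) (m : ℕ) (hm : m ≤ n)
    (y : HahnSeries ℕ A) :
    tensorCoeff N n (param k N ^ m • ofSeries k N y) = y.coeff (n - m) := by
  have h : ∀ i, (m + i = n) = (i = n - m) := fun i => by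
    rw [eq_iff_iff]; omega
  rw [ofSeries_apply, Finset.smul_sum, map_sum]
  simp only [TensorProduct.smul_tmul', smul_eq_mul, ← pow_add, tensorCoeff_param_pow_tmul N n hn, h]
  rw [Finset.sum_ite_eq', if_pos (Finset.mem_range.2 (by omega))]

/-- Division by `h` is performed before truncation, as `h` is a zero divisor afterwards. The surplus
coefficient of degree `N` disappears with `h ^ N`. -/
theorem param_smul_ofSeries_divH (y : HahnSeries ℕ A) (hy : y.coeff 0 = 0) :
    param k N • ofSeries k N (divH y) = ofSeries k N y := by
  have h := Finset.sum_range_succ (fun i => (param k N ^ i) ⊗ₜ[k] y.coeff i) N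
  rw [Finset.sum_range_succ', hy, TensorProduct.tmul_zero, add_zero, param_pow_eq_zero,
    TensorProduct.zero_tmul, add_zero] at h
  rw [ofSeries_apply, ofSeries_apply, ← h, Finset.smul_sum]
  refine Finset.sum_congr rfl fun i _ => ?_
  rw [TensorProduct.smul_tmul', smul_eq_mul, ← pow_succ']
  rfl

end TruncPoly

end Truncation

/-! ### Composition of B-series -/

section Composition

variable {k : Type*} [Field k] {A : Type*} [LeftPreLieRing A] [LeftPreLieAlgebra k A]

open TreeSpace in
theorem elementaryDifferential_tree_mk (a : A) (p : PlaneTree) :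
    elementaryDifferential k a (tree k (RTree.mk p)) = planeDiff a p := by
  have hmk : ∀ p, Finsupp.linearCombination k (fun t : RTree => planeDiff a t.rep)
      (tree k (RTree.mk p)) = planeDiff a p := by
    intro p
    simp only [tree, Finsupp.linearCombination_single, one_smul]
    exact planeDiff_iso a _ _ (RTree.mk_eq_mk.1 (RTree.mk_rep _))
  rw [← hmk p]
  generalize Finsupp.linearCombination k (fun t : RTree => planeDiff a t.rep) = F at hmk
  refine LinearMap.congr_fun (treeMorphism_ext (elementaryDifferential_spec k a) ⟨?_, hmk _⟩) _
  have h : (graft k).compr₂ F = (LinearMap.mul k A).compl₁₂ F F := by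
    ext t u
    change F (graft k (tree k t) (tree k u)) = F (tree k t) * F (tree k u)
    rw [← RTree.mk_rep t, ← RTree.mk_rep u, graft_mk, map_sum]
    simp only [hmk, sum_planeDiff_graftAt]
  exact LinearMap.congr_fun₂ h

open ForestAlgebra in
theorem convolution_X (α β : Module.Dual k (TreeSpace k)) (t : RTree) :
    convolution (character α).toLinearMap (infinitesimalCharacter β) (MvPolynomial.X t) =
      ∑ s : t.rep.SpanningSubforest,
        ((t.rep.components s).map fun q => α (TreeSpace.tree k (RTree.mk q))).prod *
          β (TreeSpace.tree k (RTree.mk (t.rep.contract s))) := by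
  have h : ∀ m : Multiset PlaneTree, character α (forest k m) =
      (m.map fun q => α (TreeSpace.tree k (RTree.mk q))).prod := by
    intro m
    rw [forest, map_multiset_prod, Multiset.map_map]
    simp [character]
  simp only [convolution, LinearMap.comp_apply, AlgHom.toLinearMap_apply, coproduct,
    MvPolynomial.aeval_X, treeCoproduct, map_sum, TensorProduct.map_tmul, LinearMap.mul'_apply, h,
    infinitesimalCharacter_X]

open ForestAlgebra in
theorem convolution_one (α β : Module.Dual k (TreeSpace k)) :
    convolution (character α).toLinearMap (infinitesimalCharacter β) 1 = 0 := by
  have h : infinitesimalCharacter β 1 = 0 := by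
    have := infinitesimalCharacter_monomial β 0
    simpa using this
  simp [convolution, Algebra.TensorProduct.one_def, h]

/-- The coproduct is defined through the chosen representative of the tree; `subforestSum_iso`
allows passing to it. -/
theorem treeForm_evalJoin_subforestSum (K : Type*) [CommRing K] [Algebra k K]
    (α β : Module.Dual k (TreeSpace k)) (p : PlaneTree) :
    treeForm (fun t => algebraMap k K (β (TreeSpace.tree k t)))
        (evalJoin (fun t => algebraMap k K (α (TreeSpace.tree k t)))
          (subforestSum (fun t => algebraMap k K (α (TreeSpace.tree k t))) p)) =
      algebraMap k K (ForestAlgebra.convolution (ForestAlgebra.character α).toLinearMap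
        (ForestAlgebra.infinitesimalCharacter β) (MvPolynomial.X (RTree.mk p))) := by
  rw [subforestSum_iso _ p (RTree.mk p).rep (RTree.mk_eq_mk.1 (RTree.mk_rep _).symm),
    convolution_X, subforestSum, map_sum, map_sum, map_sum]
  refine Finset.sum_congr rfl fun s _ => ?_
  rw [evalJoin_subforestTerm, treeForm_C_mul_X, map_mul, map_multiset_prod, Multiset.map_map]
  rfl

variable [CharZero k] (N : ℕ)

theorem sum_weight_smul_truncPoly (f : RTree → k) (F : RTree → TruncPoly k N ⊗[k] A) :
    ∑ p ∈ PlaneTree.ofOrderLT N, algebraMap ℚ (TruncPoly k N) p.weight •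
        algebraMap k (TruncPoly k N) (f (RTree.mk p)) • F (RTree.mk p) =
      ∑ m ∈ Finset.range N, ∑ t ∈ RTree.ofOrder m, (f t / (t.symmetryFactor : k)) • F t := by
  rw [RTree.sum_weight_smul N fun t => algebraMap k (TruncPoly k N) (f t) • F t]
  refine Finset.sum_congr rfl fun m _ => Finset.sum_congr rfl fun t _ => ?_
  rw [IsScalarTower.algebraMap_apply ℚ k (TruncPoly k N), algebraMap_smul (TruncPoly k N),
    algebraMap_smul (TruncPoly k N) (f t), smul_smul, div_eq_mul_inv, mul_comm]
  simp

/-- Truncation is a morphism of pre-Lie rings, and by homogeneity it sends h^{v(t)} F_x(t) to the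
elementary differential of h times the truncated series. Hence the parameter of the B-series and the
variable of the coefficients become the same `h`. -/
theorem coeff_formalBSeries_eq (β : Module.Dual k (TreeSpace k)) (x : HahnSeries ℕ A) (n : ℕ) :
    (formalBSeries (extendByZero β) x).2.coeff n = TruncPoly.tensorCoeff (n + 1) n
      (∑ p ∈ PlaneTree.ofOrderLT (n + 1), algebraMap ℚ (TruncPoly k (n + 1)) p.weight •
        algebraMap k (TruncPoly k (n + 1)) (β (TreeSpace.tree k (RTree.mk p))) •
          planeDiff (TruncPoly.param k (n + 1) • TruncPoly.ofSeries k (n + 1) x) p) := by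
  have h : ∀ p, planeDiff (TruncPoly.param k (n + 1) • TruncPoly.ofSeries k (n + 1) x) p =
      TruncPoly.param k (n + 1) ^ (RTree.mk p).order • TruncPoly.ofSeries k (n + 1)
        (elementaryDifferential k x (TreeSpace.tree k (RTree.mk p))) := fun p => by
    rw [planeDiff_smul, elementaryDifferential_tree_mk, map_planeDiff, RTree.order_mk]
  simp only [h]
  rw [sum_weight_smul_truncPoly (n + 1) (fun t => β (TreeSpace.tree k t))
    fun t => TruncPoly.param k (n + 1) ^ t.order • TruncPoly.ofSeries k (n + 1)
        (elementaryDifferential k x (TreeSpace.tree k t)), map_sum, formalBSeries,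
    coeff_formalSeries]
  refine Finset.sum_congr rfl fun m hm => ?_
  rw [map_sum]
  refine Finset.sum_congr rfl fun t ht => ?_
  rw [map_smul, RTree.mem_ofOrder.1 ht, TruncPoly.tensorCoeff_param_pow_smul_ofSeries _ _
    (Nat.lt_succ_self n) _ (Nat.lt_succ_iff.1 (Finset.mem_range.1 hm))]
  rfl

theorem ofSeries_bSeries (γ : Module.Dual k (TreeSpace k × k)) (a : A) :
    TruncPoly.ofSeries k N (bSeries γ a).2 =
      ∑ p ∈ PlaneTree.ofOrderLT N, algebraMap ℚ (TruncPoly k N) p.weight •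
        algebraMap k (TruncPoly k N) (γ (TreeSpace.tree k (RTree.mk p), 0)) •
          planeDiff (TruncPoly.param k N • tensorIncl k (TruncPoly k N) a) p := by
  have h : ∀ p, planeDiff (TruncPoly.param k N • tensorIncl k (TruncPoly k N) a) p =
      (TruncPoly.param k N ^ (RTree.mk p).order) ⊗ₜ[k]
        elementaryDifferential k a (TreeSpace.tree k (RTree.mk p)) := fun p => by
    rw [planeDiff_smul, elementaryDifferential_tree_mk, ← map_planeDiff, RTree.order_mk,
      tensorIncl_apply, TensorProduct.smul_tmul', smul_eq_mul, mul_one]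
  simp only [h]
  rw [sum_weight_smul_truncPoly N (fun t => γ (TreeSpace.tree k t, 0)) fun t =>
    (TruncPoly.param k N ^ t.order) ⊗ₜ[k] elementaryDifferential k a (TreeSpace.tree k t),
    TruncPoly.ofSeries_apply]
  refine Finset.sum_congr rfl fun m _ => ?_
  rw [bSeries, coeff_formalSeries, TensorProduct.tmul_sum]
  refine Finset.sum_congr rfl fun t ht => ?_
  rw [RTree.mem_ofOrder.1 ht, TensorProduct.tmul_smul]
  rfl

end Composition

theorem mainTheorem5 {k : Type*} [Field k] [CharZero k] {A : Type*} [LeftPreLieRing A]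
    [LeftPreLieAlgebra k A] (a : A) (α β : Module.Dual k (TreeSpace k)) :
    formalBSeries (extendByZero β) (divH (bSeries (extendByZero α) a).2) =
      bSeries (ForestAlgebra.restrict
        (ForestAlgebra.convolution (ForestAlgebra.character α).toLinearMap
          (ForestAlgebra.infinitesimalCharacter β))) a := by
  refine Prod.ext ?_ (HahnSeries.ext (funext fun n => ?_))
  · change β 0 = ForestAlgebra.convolution _ _ _
    simp [convolution_one]
  -- The truncation order `n + 1` is the least one that keeps the coefficient of degree `n`, and it
  -- is positive, as the group law needs.
  · have hcoeff := TruncPoly.tensorCoeff_param_pow_smul_ofSeries (n + 1) n (Nat.lt_succ_self n) 0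
      (Nat.zero_le n) (k := k) (A := A)
    simp only [pow_zero, one_smul, Nat.sub_zero] at hcoeff
    rw [coeff_formalBSeries_eq, ← hcoeff, ofSeries_bSeries]
    refine congrArg _ ?_
    refine (sum_planeDiff_substitution (Nat.succ_pos n) (TruncPoly.param_pow_eq_zero k (n + 1))
      (fun t => algebraMap k (TruncPoly k (n + 1)) (α (TreeSpace.tree k t)))
      (fun t => algebraMap k (TruncPoly k (n + 1)) (β (TreeSpace.tree k t)))
      (tensorIncl k (TruncPoly k (n + 1)) a) _ ?_).trans ?_
    -- The inner B-series has no constant term, so `h` times the truncation of its quotient by `h`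
    -- is its own truncation.
    · rw [TruncPoly.param_smul_ofSeries_divH _ _ (coeff_zero_bSeries _ _), ofSeries_bSeries]
      rfl
    · refine Finset.sum_congr rfl fun p _ => ?_
      rw [treeForm_evalJoin_subforestSum]
      congr 3
      simp [ForestAlgebra.restrict, TreeSpace.tree]
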